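/- Let $d\ge 2$, $\omega=e^{2\pi \mathrm{i}/d}$, $\omega^t:=e^{2\pi \mathrm{i}t/d}$ for real $t$, and $a_k=\frac{1-\mathrm{i}}{2}e^{\pi \mathrm{i}k/(2d)}$. A strategy consists of a dimension $D\ge 1$ and four $d$-outcome measurements $A_1,\dots,A_4$ on $\mathbb{C}^D$, where $A_i$ is given by one Kraus operator $K_i^{a}$ for each outcome $a\in\{0,\dots,d-1\}$, with $\sum_a (K_i^a)^\dagger K_i^a=\mathbb{1}$. When $A_i$ is measured on the maximally mixed state $\mathbb{1}/D$ and $A_j$ is then measured on the post-measurement state, the statistics are $$p(a|A_i)=\tfrac1D\operatorname{Tr}[K_i^a (K_i^a)^\dagger],\quad p(a,b|A_i,A_j)=\tfrac1D\operatorname{Tr}[K_j^bK_i^a (K_i^a)^\dagger (K_j^b)^\dagger],\quad p(b|A_i,A_j,a)=\frac{p(a,b|A_i,A_j)}{p(a|A_i)}.$$ Put $\langle A_i^kA_j^l\rangle=\sum_{a,b=0}^{d-1}\omega^{ak+bl}\,p(a,b|A_i,A_j)$ and $$\tau_d=\sum_{k=1}^{d-1}\Big[a_k\langle A_1^kA_3^{d-k}\rangle+a_k^*\omega^k\langle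 A_1^kA_4^{d-k}\rangle+a_k^*\langle A_2^kA_3^{d-k}\rangle+a_k\langle A_2^kA_4^{d-k}\rangle$$ $$\qquad\qquad+a_k\langle A_3^{d-k}A_1^k\rangle+a_k^*\omega^k\langle A_4^{d-k}A_1^k\rangle+a_k^*\langle A_3^{d-k}A_2^k\rangle+a_k\langle A_4^{d-k}A_2^k\rangle\Big].$$ Let $\mathcal S$ be the set of all strategies (of any dimension $D$) such that $p(a,a|A_i,A_i)=p(a|A_i)$ for all $i$ and all $a$ (projectivity condition) and $\tau_d=4(d-1)$ (maximal violation). The certified randomness of the second outcome is $$\mathcal H(A_i,A_j)=\min_{\mathcal S}\Big[-\sum_{a=0}^{d-1}p(a|A_i)\sum_{b=0}^{d-1}p(b|A_i,A_j,a)\log_2 p(b|A_i,A_j,a)\Big],$$ with the conventions that $0\log_2 0=0$ and that terms with $p(a|A_i)=0$ vanish. Let $Z_d=\sum_{q}\omega^q|q\rangle\langle q|$, $T_d=\sum_{q}\omega^{q+1/2}|q\rangle\langle q|-\frac2d\sum_{q,r}(-1)^{\delta_{q,0}+\delta_{r,0}}\omega^{(q+r+1)/2}|q\rangle\langle r|$,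 $M_d=a_1Z_d+a_1^*T_d$ and $N_d=\omega a_1^*Z_d+a_1T_d$ on $\mathbb{C}^d$ (sums over $0\le q,r\le d-1$). Then: 1. For all $i,j\in\{1,2,3,4\}$ the minimum exists, and every strategy in $\mathcal S$ attains it. 2. Each of $Z_d,T_d,M_d,N_d$ has, for every $a\in\{0,\dots,d-1\}$, a normalized eigenvector with eigenvalue $\omega^a$. For any choice of such eigenvectors, written $|A_1^a\rangle,|A_2^a\rangle,|A_3^a\rangle,|A_4^a\rangle$ respectively, one has for all $i,j$ and every $a$ $$\mathcal H(A_i,A_j)=-\sum_{b=0}^{d-1}\big|\langle A_i^{a}|A_j^{b}\rangle\big|^2\log_2\big|\langle A_i^{a}|A_j^{b}\rangle\big|^2,$$ and $\big|\langle A_1^{a}|A_2^{b}\rangle\big|^2=\frac{4}{d^2}\,\big|1-\omega^{b-a-1/2}\big|^{-2}$ for all $a,b$. 3. $\mathcal H(A_i,A_i)=0$ for every $i$. 4. $$\mathcal H(A_1,A_2)=\mathcal H(A_2,A_1)=\mathcal H(A_3,A_4)=\mathcal H(A_4,A_3)=-\sum_{x=0}^{d-1}\frac{4}{d^2}\frac{1}{|1-\omega^{x-1/2}|^{2}}\log_2\!\left[\frac{4}{d^2}\frac{1}{|1-\omega^{x-1/2}|^{2}}\right].$$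 -/

import Mathlib

open scoped Matrix

noncomputable section

namespace TemporalRandomness

/-- The power `ω ^ t` of `ω = exp (2 π i / d)` for a real exponent `t`,
with the convention `ω ^ t = exp (2 π i t / d)`. -/
def omegaPow (d : ℕ) (t : ℝ) : ℂ :=
  Complex.exp (2 * Real.pi * Complex.I * t / d)

/-- A measurement with outcomes `0, …, d - 1` on `ℂ^D`, with one Kraus operator per outcome.
The POVM element of the outcome `a` is `(kraus a)ᴴ * kraus a`; by polar decomposition a
Kraus operator with POVM element `M` is the same thing as `U * √M` with `U` unitary. -/
structure Measurement (d D : ℕ) where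
  kraus : Fin d → Matrix (Fin D) (Fin D) ℂ
  complete : ∑ a, (kraus a)ᴴ * kraus a = 1

/-- Four measurements `A_1, A_2, A_3, A_4`; the index `i : Fin 4` stands for `A_{i+1}`. -/
abbrev Strategy (d D : ℕ) : Type := Fin 4 → Measurement d D

/-- The maximally mixed state `𝟙 / D`. -/
def maximallyMixed (D : ℕ) : Matrix (Fin D) (Fin D) ℂ := (D : ℂ)⁻¹ • 1

variable {d D : ℕ}

/-- The unnormalized state after the outcome `a` of `A` on the maximally mixed state. -/
def postState (A : Measurement d D) (a : Fin d) : Matrix (Fin D) (Fin D) ℂ :=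
  A.kraus a * maximallyMixed D * (A.kraus a)ᴴ

/-- `p(a | A)`: the probability of the outcome `a` of `A` on the maximally mixed state. -/
def prob (A : Measurement d D) (a : Fin d) : ℝ :=
  (Matrix.trace (postState A a)).re

/-- `p(a, b | A, B)`: the probability of the outcome `a` when `A` is measured on the maximally
mixed state and of the outcome `b` when `B` is then measured on the post-measurement state. -/
def jointProb (A B : Measurement d D) (a b : Fin d) : ℝ :=
  (Matrix.trace (B.kraus b * postState A a * (B.kraus b)ᴴ)).re

/-- `p(a | A)` is the marginal of `p(a, b | A, B)`, for every second measurement `B`. -/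
theorem sum_jointProb (A B : Measurement d D) (a : Fin d) :
    ∑ b, jointProb A B a b = prob A a := by
  unfold jointProb prob
  rw [← Complex.re_sum, ← Matrix.trace_sum]
  have h : ∀ b, Matrix.trace (B.kraus b * postState A a * (B.kraus b)ᴴ)
      = Matrix.trace ((B.kraus b)ᴴ * B.kraus b * postState A a) := fun b => by
    rw [Matrix.trace_mul_comm, Matrix.mul_assoc]
  rw [Matrix.trace_sum, Finset.sum_congr rfl fun b _ => h b, ← Matrix.trace_sum,
    ← Finset.sum_mul, B.complete, Matrix.one_mul]

/-- `p(b | A, B, a) = p(a, b | A, B) / p(a | A)`. -/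
def condProb (A B : Measurement d D) (a b : Fin d) : ℝ :=
  jointProb A B a b / prob A a

/-- The projectivity condition `p(a, a | A, A) = p(a | A)` for all outcomes `a`. -/
def IsRepeatable (A : Measurement d D) : Prop :=
  ∀ a, jointProb A A a a = prob A a

/-- `⟨A^(k) B^(l)⟩ = ∑_{a,b} ω^{a k + b l} p(a, b | A, B)`, where `A` is measured first. -/
def correlator (A B : Measurement d D) (k l : ℕ) : ℂ :=
  ∑ a : Fin d, ∑ b : Fin d,
    omegaPow d ((a : ℝ) * k + (b : ℝ) * l) * (jointProb A B a b : ℂ)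

/-- `a_k = ((1 - i) / 2) exp (π i k / (2 d))`. -/
def coeff (d k : ℕ) : ℂ :=
  (1 - Complex.I) / 2 * Complex.exp (Real.pi * Complex.I * k / (2 * d))

open scoped ComplexConjugate in
/-- The temporal expression `τ_d`. -/
def temporalValue (A : Strategy d D) : ℂ :=
  ∑ k ∈ Finset.Icc 1 (d - 1),
    (coeff d k * correlator (A 0) (A 2) k (d - k)
      + conj (coeff d k) * omegaPow d k * correlator (A 0) (A 3) k (d - k)
      + conj (coeff d k) * correlator (A 1) (A 2) k (d - k)
      + coeff d k * correlator (A 1) (A 3) k (d - k)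
      + coeff d k * correlator (A 2) (A 0) (d - k) k
      + conj (coeff d k) * omegaPow d k * correlator (A 3) (A 0) (d - k) k
      + conj (coeff d k) * correlator (A 2) (A 1) (d - k) k
      + coeff d k * correlator (A 3) (A 1) (d - k) k)

/-- The admissible strategies: all four measurements satisfy the projectivity condition,
and the temporal expression takes its maximal quantum value `4 (d - 1)`. -/
structure IsOptimal (A : Strategy d D) : Prop where
  dim_pos : 0 < D
  repeatable : ∀ i, IsRepeatable (A i)
  value : temporalValue A = 4 * ((d : ℂ) - 1)

/-- The Shannon entropy (in bits) of the outcome of the second measurement `B`, given the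
outcome of the first measurement `A`, averaged over the latter. -/
def outcomeEntropy (A B : Measurement d D) : ℝ :=
  -∑ a, prob A a * ∑ b, condProb A B a b * Real.logb 2 (condProb A B a b)

/-- The values of the averaged entropy over all admissible strategies, in all dimensions. -/
def strategyEntropies (d : ℕ) (i j : Fin 4) : Set ℝ :=
  {h | ∃ (D : ℕ) (A : Strategy d D), IsOptimal A ∧ h = outcomeEntropy (A i) (A j)}

/-- The certified randomness `H(A_i, A_j)`: the minimum of the averaged entropy over all
admissible strategies. -/
def certifiedRandomness (d : ℕ) (i j : Fin 4) : ℝ :=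
  sInf (strategyEntropies d i j)

/-- `Z_d = ∑ ω^i |i⟩⟨i|`. -/
def obsZ (d : ℕ) : Matrix (Fin d) (Fin d) ℂ :=
  Matrix.diagonal fun i => omegaPow d (i : ℝ)

/-- `T_d = ∑ ω^{i+1/2} |i⟩⟨i| - (2/d) ∑ (-1)^{δ_{i,0} + δ_{j,0}} ω^{(i+j+1)/2} |i⟩⟨j|`. -/
def obsT (d : ℕ) : Matrix (Fin d) (Fin d) ℂ :=
  Matrix.diagonal (fun i : Fin d => omegaPow d ((i : ℝ) + 1 / 2))
    - (2 / (d : ℂ)) • Matrix.of fun i j : Fin d =>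
        (if (i : ℕ) = 0 then (-1 : ℂ) else 1) * (if (j : ℕ) = 0 then (-1 : ℂ) else 1)
          * omegaPow d (((i : ℝ) + (j : ℝ) + 1) / 2)

open scoped ComplexConjugate in
/-- The `d`-dimensional observables `Z_d`, `T_d`, `M_d = a_1 Z_d + a_1^* T_d` and
`N_d = ω a_1^* Z_d + a_1 T_d` that correspond to `A_1, A_2, A_3, A_4`. -/
def refObs (d : ℕ) : Fin 4 → Matrix (Fin d) (Fin d) ℂ :=
  ![obsZ d,
    obsT d,
    coeff d 1 • obsZ d + conj (coeff d 1) • obsT d,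
    (omegaPow d 1 * conj (coeff d 1)) • obsZ d + coeff d 1 • obsT d]

/-- `v i a` is a normalized eigenvector of the `i`-th observable with eigenvalue `ω^a`. -/
def IsEigenstateFamily (v : Fin 4 → Fin d → EuclideanSpace ℂ (Fin d)) : Prop :=
  ∀ i a, ‖v i a‖ = 1 ∧
    Matrix.toEuclideanLin (refObs d i) (v i a) = omegaPow d (a : ℝ) • v i a

/-- `|⟨u | v⟩|²`. -/
def overlap (u v : EuclideanSpace ℂ (Fin d)) : ℝ := ‖inner ℂ u v‖ ^ 2

/-- `(4 / d²) |1 - ω^t|⁻²`. -/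
def closedFormProb (d : ℕ) (t : ℝ) : ℝ :=
  4 / (d : ℝ) ^ 2 * (1 / ‖1 - omegaPow d t‖ ^ 2)

/-- `- ∑_x (4 / d²) |1 - ω^{x - 1/2}|⁻² log₂ [(4 / d²) |1 - ω^{x - 1/2}|⁻²]`. -/
def closedFormEntropy (d : ℕ) : ℝ :=
  -∑ x ∈ Finset.range d,
    closedFormProb d ((x : ℝ) - 1 / 2) * Real.logb 2 (closedFormProb d ((x : ℝ) - 1 / 2))

end TemporalRandomness

end

/-!
Maximal violation forces the eight defect terms of a sum-of-squares decomposition of the Bell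
operator to vanish, so the powers of the third and fourth observables are fixed combinations of
the powers of the first two. These relations make all four observables twisted shifts of one
another: up to diagonal phases in a common decomposition of the identity into `d` projections,
each is a unitary that permutes the projections cyclically. The trace overlaps of their spectral
projections are then values of the normalized Fejér kernel at differences of four fixed phases,
whatever the strategy is; the eigenvectors of `Z_d`, `T_d`, `M_d`, `N_d` realize the same values.
-/

open scoped Matrix

noncomputable section

namespace TemporalRandomness

open Finset
open scoped ComplexConjugate

/-! ### Roots of unity -/

theorem omegaPow_zero (d : ℕ) : omegaPow d 0 = 1 := by simp [omegaPow]

theorem omegaPow_add (d : ℕ) (s t : ℝ) : omegaPow d (s + t) = omegaPow d s * omegaPow d t := by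
  rw [omegaPow, omegaPow, omegaPow, ← Complex.exp_add]
  congr 1
  push_cast
  ring

theorem omegaPow_ne_zero (d : ℕ) (t : ℝ) : omegaPow d t ≠ 0 := Complex.exp_ne_zero _

theorem norm_omegaPow (d : ℕ) (t : ℝ) : ‖omegaPow d t‖ = 1 := by
  have : (2 * Real.pi * Complex.I * t / d : ℂ) = ((2 * Real.pi * t / d : ℝ) : ℂ) * Complex.I := by
    push_cast; ring
  rw [omegaPow, this, Complex.norm_exp_ofReal_mul_I]

theorem omegaPow_neg (d : ℕ) (t : ℝ) : omegaPow d (-t) = (omegaPow d t)⁻¹ := by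
  refine eq_inv_of_mul_eq_one_left ?_
  rw [← omegaPow_add, neg_add_cancel, omegaPow_zero]

theorem omegaPow_sub (d : ℕ) (s t : ℝ) :
    omegaPow d (s - t) = omegaPow d s * (omegaPow d t)⁻¹ := by
  rw [sub_eq_add_neg, omegaPow_add, omegaPow_neg]

theorem conj_omegaPow (d : ℕ) (t : ℝ) : conj (omegaPow d t) = (omegaPow d t)⁻¹ :=
  (Complex.inv_eq_conj (norm_omegaPow d t)).symm

theorem omegaPow_natCast_mul (d n : ℕ) (t : ℝ) : omegaPow d (n * t) = omegaPow d t ^ n := by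
  rw [omegaPow, omegaPow, ← Complex.exp_nat_mul]
  congr 1
  push_cast
  ring

theorem omegaPow_natCast (d n : ℕ) : omegaPow d n = omegaPow d 1 ^ n := by
  rw [← omegaPow_natCast_mul, mul_one]

theorem omegaPow_pow_self {d : ℕ} (hd : d ≠ 0) (t : ℝ) :
    omegaPow d t ^ d = Complex.exp (2 * Real.pi * Complex.I * t) := by
  have h : (d : ℂ) ≠ 0 := Nat.cast_ne_zero.2 hd
  rw [omegaPow, ← Complex.exp_nat_mul, mul_div_cancel₀ _ h]

theorem isPrimitiveRoot_omegaPow_one {d : ℕ} (hd : d ≠ 0) :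
    IsPrimitiveRoot (omegaPow d 1) d := by
  simpa [omegaPow] using Complex.isPrimitiveRoot_exp d hd

theorem omegaPow_natCast_pow_self {d : ℕ} (hd : d ≠ 0) (n : ℕ) : omegaPow d n ^ d = 1 := by
  rw [omegaPow_natCast, pow_right_comm, (isPrimitiveRoot_omegaPow_one hd).pow_eq_one, one_pow]

theorem omegaPow_half_pow_self {d : ℕ} (hd : d ≠ 0) : omegaPow d (1 / 2) ^ d = -1 := by
  rw [omegaPow_pow_self hd]
  refine Eq.trans (congrArg Complex.exp ?_) Complex.exp_pi_mul_I
  push_cast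
  ring

theorem omegaPow_quarter_pow_self {d : ℕ} (hd : d ≠ 0) : omegaPow d (1 / 4) ^ d = Complex.I := by
  rw [omegaPow_pow_self hd]
  refine Eq.trans (congrArg Complex.exp ?_) Complex.exp_pi_div_two_mul_I
  push_cast
  ring

theorem omegaPow_three_quarters_pow_self {d : ℕ} (hd : d ≠ 0) :
    omegaPow d (3 / 4) ^ d = -Complex.I := by
  rw [show (3 / 4 : ℝ) = 1 / 2 + 1 / 4 by norm_num, omegaPow_add, mul_pow,
    omegaPow_half_pow_self hd, omegaPow_quarter_pow_self hd, neg_one_mul]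

theorem one_sub_inv_omegaPow_half_pow_self {d : ℕ} (hd : d ≠ 0) :
    1 - (omegaPow d (1 / 2) ^ d)⁻¹ = 2 := by
  rw [omegaPow_half_pow_self hd]
  norm_num

theorem one_sub_inv_omegaPow_quarter_pow_self {d : ℕ} (hd : d ≠ 0) :
    1 - (omegaPow d (1 / 4) ^ d)⁻¹ = 1 + Complex.I := by
  rw [omegaPow_quarter_pow_self hd, Complex.inv_I, sub_neg_eq_add]

theorem one_sub_inv_omegaPow_three_quarters_pow_self {d : ℕ} (hd : d ≠ 0) :
    1 - (omegaPow d (3 / 4) ^ d)⁻¹ = 1 - Complex.I := by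
  rw [omegaPow_three_quarters_pow_self hd, inv_neg, Complex.inv_I, neg_neg]

theorem omegaPow_pow_eq {d k n : ℕ} {t : ℝ} (ht : t = n / 4) :
    omegaPow d t ^ k = omegaPow d (k / 4) ^ n := by
  rw [← omegaPow_natCast_mul, ← omegaPow_natCast_mul, ht, mul_div_left_comm]

theorem omegaPow_add_self {d : ℕ} (hd : d ≠ 0) (t : ℝ) : omegaPow d (t + d) = omegaPow d t := by
  rw [omegaPow_add, omegaPow_natCast, (isPrimitiveRoot_omegaPow_one hd).pow_eq_one, mul_one]

theorem coeff_eq (d k : ℕ) : coeff d k = (1 - Complex.I) / 2 * omegaPow d (k / 4) := by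
  rw [coeff, omegaPow]
  congr 2
  push_cast
  ring

theorem conj_coeff (d k : ℕ) :
    conj (coeff d k) = (1 + Complex.I) / 2 * (omegaPow d (k / 4))⁻¹ := by
  simp only [coeff_eq, map_mul, map_div₀, map_sub, map_one, Complex.conj_I, map_ofNat,
    conj_omegaPow, sub_neg_eq_add]

theorem inv_mul_omegaPow_ne_one {d : ℕ} {a b : Fin d} (h : a ≠ b) :
    (omegaPow d a)⁻¹ * omegaPow d b ≠ 1 := by
  have hd : d ≠ 0 := (Fin.pos a).ne'
  rw [ne_eq, inv_mul_eq_one₀ (omegaPow_ne_zero d _), omegaPow_natCast, omegaPow_natCast]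
  exact fun hab => h (Fin.ext ((isPrimitiveRoot_omegaPow_one hd).pow_inj a.2 b.2 hab))

theorem geom_sum_eq_zero {z : ℂ} {n : ℕ} (hz : z ≠ 1) (hzn : z ^ n = 1) :
    ∑ k ∈ range n, z ^ k = 0 := by
  rw [geom_sum_eq hz, hzn, sub_self, zero_div]

theorem sum_inv_mul_omegaPow_pow {d : ℕ} (a b : Fin d) :
    ∑ k ∈ range d, ((omegaPow d a)⁻¹ * omegaPow d b) ^ k = if a = b then (d : ℂ) else 0 := by
  have hd : d ≠ 0 := (Fin.pos a).ne'
  split_ifs with h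
  · simp [h, inv_mul_cancel₀ (omegaPow_ne_zero d _)]
  · refine geom_sum_eq_zero (inv_mul_omegaPow_ne_one h) ?_
    rw [mul_pow, inv_pow, omegaPow_natCast_pow_self hd, omegaPow_natCast_pow_self hd, inv_one,
      one_mul]

theorem sum_omegaPow_pow {d k : ℕ} (hk : k < d) :
    ∑ a : Fin d, omegaPow d a ^ k = if k = 0 then (d : ℂ) else 0 := by
  have hd : 0 < d := by omega
  have h := sum_inv_mul_omegaPow_pow (⟨0, hd⟩ : Fin d) ⟨k, hk⟩
  simp only [Nat.cast_zero, omegaPow_zero, inv_one, one_mul, Fin.mk.injEq, eq_comm (a := 0)] at h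
  rw [← h, ← Fin.sum_univ_eq_sum_range (fun j => omegaPow d k ^ j)]
  refine sum_congr rfl fun a _ => ?_
  rw [omegaPow_natCast, omegaPow_natCast d k, pow_right_comm]

theorem sum_inv_omegaPow_pow {d k : ℕ} (hk : k < d) :
    ∑ a : Fin d, (omegaPow d a)⁻¹ ^ k = if k = 0 then (d : ℂ) else 0 := by
  have h := congrArg conj (sum_omegaPow_pow hk)
  simpa only [map_sum, map_pow, conj_omegaPow, apply_ite conj, map_natCast, map_zero] using h

/-! ### The Fejér kernel -/

/-- The normalized Fejér kernel `|d⁻¹ ∑_{j < d} ω^{t j}|²`. At integers and half-integers `t` it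
gives the transition probabilities between the outcomes of the four measurements. -/
def fejerKernel (d : ℕ) (t : ℝ) : ℝ := ‖(d : ℂ)⁻¹ * ∑ j ∈ range d, omegaPow d t ^ j‖ ^ 2

theorem fejerKernel_neg (d : ℕ) (t : ℝ) : fejerKernel d (-t) = fejerKernel d t := by
  rw [fejerKernel, fejerKernel, norm_mul, norm_mul, ← Complex.norm_conj (∑ j ∈ range d, _)]
  simp only [map_sum, map_pow, omegaPow_neg, map_inv₀, conj_omegaPow, inv_inv]

theorem fejerKernel_add_self {d : ℕ} (hd : d ≠ 0) (t : ℝ) :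
    fejerKernel d (t + d) = fejerKernel d t := by
  rw [fejerKernel, fejerKernel, omegaPow_add_self hd]

theorem fejerKernel_zero {d : ℕ} (hd : d ≠ 0) : fejerKernel d 0 = 1 := by
  simp [fejerKernel, omegaPow_zero, hd]

theorem fejerKernel_sub_eq_zero {d : ℕ} {a b : Fin d} (h : a ≠ b) :
    fejerKernel d ((b : ℝ) - a) = 0 := by
  rw [fejerKernel, omegaPow_sub, mul_comm (omegaPow d _), sum_inv_mul_omegaPow_pow, if_neg h]
  simp

theorem ofReal_fejerKernel (d : ℕ) (t : ℝ) :
    (fejerKernel d t : ℂ) = ((d : ℂ) ^ 2)⁻¹ *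
      ((∑ j ∈ range d, omegaPow d t ^ j) * ∑ j ∈ range d, (omegaPow d t)⁻¹ ^ j) := by
  rw [fejerKernel, Complex.ofReal_pow, ← Complex.mul_conj', map_mul, map_inv₀, map_natCast, map_sum]
  simp only [map_pow, conj_omegaPow]
  ring

theorem fejerKernel_eq_closedFormProb {d : ℕ} {t : ℝ} (ht : omegaPow d t ^ d = -1) :
    fejerKernel d t = closedFormProb d t := by
  have ht1 : omegaPow d t ≠ 1 := by
    intro h
    rw [h, one_pow] at ht
    norm_num at ht
  rw [fejerKernel, closedFormProb, geom_sum_eq ht1, ht, norm_mul, norm_div, norm_inv,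
    norm_sub_rev (omegaPow d t)]
  norm_num
  ring

/-! ### Spectral projections of elements of finite order -/

section SpectralProjections

variable {R : Type*} [Ring R] [Algebra ℂ R] {d : ℕ}

theorem sum_smul_mul_sum_smul {ι : Type*} [Fintype ι] {e : ι → R} (he : OrthogonalIdempotents e)
    (x y : ι → ℂ) : (∑ i, x i • e i) * ∑ i, y i • e i = ∑ i, (x i * y i) • e i := by
  classical
  simp only [sum_mul_sum, smul_mul_smul_comm, he.mul_eq, smul_ite, smul_zero, sum_ite_eq, mem_univ,
    if_true]

theorem sum_smul_pow {ι : Type*} [Fintype ι] {e : ι → R} (he : CompleteOrthogonalIdempotents e)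
    (x : ι → ℂ) (k : ℕ) : (∑ i, x i • e i) ^ k = ∑ i, x i ^ k • e i := by
  induction k with
  | zero => simp only [pow_zero, one_smul, he.complete]
  | succ k ih => simp only [pow_succ, ih, sum_smul_mul_sum_smul he.toOrthogonalIdempotents]

/-- The spectral projection of an element `U` with `U ^ d = 1` for the eigenvalue `ω ^ a`. -/
def spectralProj (d : ℕ) (U : R) (a : Fin d) : R :=
  (d : ℂ)⁻¹ • ∑ k ∈ range d, ((omegaPow d a)⁻¹ • U) ^ k

theorem spectralProj_sum_smul {e : Fin d → R} (he : CompleteOrthogonalIdempotents e) (a : Fin d) :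
    spectralProj d (∑ b : Fin d, omegaPow d b • e b) a = e a := by
  have hd : (d : ℂ) ≠ 0 := Nat.cast_ne_zero.2 (Fin.pos a).ne'
  have hpow (k : ℕ) : ((omegaPow d a)⁻¹ • ∑ b : Fin d, omegaPow d b • e b) ^ k
      = ∑ b : Fin d, ((omegaPow d a)⁻¹ * omegaPow d b) ^ k • e b := by
    simp only [← sum_smul_pow he, smul_sum, smul_smul]
  simp only [spectralProj, hpow]
  rw [sum_comm]
  simp only [← sum_smul, sum_inv_mul_omegaPow_pow, ite_smul, zero_smul, sum_ite_eq, mem_univ,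
    if_true, smul_smul, inv_mul_cancel₀ hd, one_smul]

theorem sum_spectralProj (hd : d ≠ 0) (U : R) : ∑ a, spectralProj d U a = 1 := by
  have hsum : ∀ k ∈ range d, ∑ a : Fin d, ((omegaPow d a)⁻¹ • U) ^ k
      = if k = 0 then (d : ℂ) • 1 else 0 := fun k hk => by
    simp only [smul_pow, ← sum_smul, sum_inv_omegaPow_pow (mem_range.1 hk)]
    split_ifs with h <;> simp [h]
  simp only [spectralProj]
  rw [← smul_sum, sum_comm, sum_congr rfl hsum, sum_ite_eq' (range d) 0,
    if_pos (mem_range.2 (by omega)), smul_smul, inv_mul_cancel₀ (Nat.cast_ne_zero.2 hd), one_smul]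

variable {U V g : R}

theorem mul_spectralProj (hU : U ^ d = 1) (a : Fin d) :
    U * spectralProj d U a = omegaPow d a • spectralProj d U a := by
  have hd : d ≠ 0 := (Fin.pos a).ne'
  have h := mul_geom_sum ((omegaPow d a)⁻¹ • U) d
  rw [smul_pow, hU, inv_pow, omegaPow_natCast_pow_self hd, inv_one, one_smul, sub_self, sub_mul,
    one_mul, sub_eq_zero, smul_mul_assoc, inv_smul_eq_iff₀ (omegaPow_ne_zero d _)] at h
  rw [spectralProj, mul_smul_comm, h, smul_comm]

theorem semiconjBy_spectralProj (h : SemiconjBy g U V) (a : Fin d) :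
    SemiconjBy g (spectralProj d U a) (spectralProj d V a) := by
  simp only [SemiconjBy, spectralProj, smul_pow, mul_smul_comm, smul_mul_assoc, mul_sum, sum_mul,
    (h.pow_right _).eq]

theorem pow_mul_spectralProj (hU : U ^ d = 1) (a : Fin d) (k : ℕ) :
    U ^ k * spectralProj d U a = omegaPow d a ^ k • spectralProj d U a := by
  induction k with
  | zero => simp
  | succ k ih =>
    rw [pow_succ, mul_assoc, mul_spectralProj hU, mul_smul_comm, ih, smul_smul, pow_succ']

theorem spectralProj_mul_pow (hU : U ^ d = 1) (a : Fin d) (k : ℕ) :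
    spectralProj d U a * U ^ k = omegaPow d a ^ k • spectralProj d U a := by
  rw [← (semiconjBy_spectralProj ((Commute.refl U).pow_left k) a).eq, pow_mul_spectralProj hU]

theorem sum_smul_spectralProj (hd : d ≠ 0) (hU : U ^ d = 1) :
    ∑ a : Fin d, omegaPow d a • spectralProj d U a = U := by
  simp only [← mul_spectralProj hU, ← mul_sum, sum_spectralProj hd, mul_one]

end SpectralProjections

theorem pow_sub_eq_star_pow {M : Type*} [Monoid M] [StarMul M] {U : M} {d : ℕ} (hU : U ^ d = 1)
    (hU' : U ∈ unitary M) {k : ℕ} (hk : k ≤ d) : U ^ (d - k) = star (U ^ k) := by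
  have h : star (U ^ k) * U ^ k = 1 := (pow_mem hU' k).1
  rw [← one_mul (U ^ (d - k)), ← h, mul_assoc, pow_mul_pow_sub U hk, hU, mul_one]

section StarSpectralProjections

variable {R : Type*} [Ring R] [StarRing R] [Algebra ℂ R] [StarModule ℂ R] {d : ℕ} {U : R}

theorem star_pow_mul_spectralProj (hU : U ^ d = 1) (hU' : U ∈ unitary R) (a : Fin d) (k : ℕ) :
    star (((omegaPow d a)⁻¹ • U) ^ k) * spectralProj d U a = spectralProj d U a := by
  have hω : star ((omegaPow d a)⁻¹ ^ k) = omegaPow d a ^ k := by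
    rw [← starRingEnd_apply, map_pow, map_inv₀, conj_omegaPow, inv_inv]
  have h : star (U ^ k) * U ^ k = 1 := (pow_mem hU' k).1
  rw [smul_pow, star_smul, hω, smul_mul_assoc, ← mul_smul_comm, ← pow_mul_spectralProj hU,
    ← mul_assoc, h, one_mul]

theorem isStarProjection_spectralProj (hU : U ^ d = 1) (hU' : U ∈ unitary R) (a : Fin d) :
    IsStarProjection (spectralProj d U a) := by
  have hd : (d : ℂ) ≠ 0 := Nat.cast_ne_zero.2 (Fin.pos a).ne'
  have h : star (spectralProj d U a) * spectralProj d U a = spectralProj d U a := by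
    conv_lhs => rw [spectralProj, star_smul, star_sum, ← spectralProj, smul_mul_assoc, sum_mul]
    rw [sum_congr rfl fun k _ => star_pow_mul_spectralProj hU hU' a k, sum_const, card_range,
      ← Nat.cast_smul_eq_nsmul ℂ, smul_smul, star_inv₀, star_natCast, inv_mul_cancel₀ hd, one_smul]
  have hsa : IsSelfAdjoint (spectralProj d U a) := h ▸ IsSelfAdjoint.star_mul_self _
  exact ⟨by rwa [hsa.star_eq] at h, hsa⟩

end StarSpectralProjections

/-! ### Shift resolutions of the identity -/

section ShiftResolutions

variable {R : Type*} [Ring R] {d : ℕ} {u : Rˣ} {r : R}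

/-- The conjugate `u ^ j * r * u ^ (-j)`. -/
def translate (u : Rˣ) (r : R) (j : ℕ) : R := ConjAct.toConjAct u ^ j • r

theorem translate_zero (u : Rˣ) (r : R) : translate u r 0 = r := by
  rw [translate, pow_zero, one_smul]

theorem translate_succ (u : Rˣ) (r : R) (j : ℕ) :
    translate u r (j + 1) = ConjAct.toConjAct u • translate u r j := by
  rw [translate, translate, pow_succ', mul_smul]

theorem units_mul_eq_smul_mul (u : Rˣ) (x : R) : ↑u * x = (ConjAct.toConjAct u • x) * u := by
  rw [ConjAct.units_smul_def, ConjAct.ofConjAct_toConjAct, Units.inv_mul_cancel_right]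

theorem translate_mul_pow (u : Rˣ) (r : R) (j : ℕ) :
    translate u r j * (u : R) ^ j = (u : R) ^ j * r := by
  rw [translate, ← map_pow, ← Units.val_pow_eq_pow_val, units_mul_eq_smul_mul]

theorem translate_add_self (hu : u ^ d = 1) (r : R) (j : ℕ) :
    translate u r (d + j) = translate u r j := by
  rw [translate, translate, pow_add, ← map_pow, hu, map_one, one_mul]

theorem translate_mul_translate_add (u : Rˣ) (r : R) (i j : ℕ) :
    translate u r i * translate u r (i + j) = ConjAct.toConjAct u ^ i • (r * translate u r j) := by
  rw [smul_mul', translate, translate, translate, pow_add, mul_smul]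

/-- `u` has order dividing `d`, and the conjugates of `r` under the powers of `u` are complete
orthogonal idempotents: `u` permutes cyclically the summands of a decomposition into `d` pieces,
one of which is cut out by `r`. -/
structure IsShiftResolution (d : ℕ) (u : Rˣ) (r : R) : Prop where
  pow_eq_one : u ^ d = 1
  complete : CompleteOrthogonalIdempotents fun j : Fin d => translate u r j

theorem isShiftResolution_of_mul_translate_eq_zero (hu : u ^ d = 1)
    (hr : ∀ j, 0 < j → j < d → r * translate u r j = 0)
    (hsum : ∑ j ∈ range d, translate u r j = 1) : IsShiftResolution d u r := by
  refine ⟨hu, CompleteOrthogonalIdempotents.iff_ortho_complete.2 ⟨fun i j hij => ?_, ?_⟩⟩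
  · rcases lt_or_gt_of_ne hij with h | h
    · have hj : (j : ℕ) = i + (j - i) := by omega
      change translate u r i * translate u r j = 0
      rw [hj, translate_mul_translate_add, hr _ (by omega) (by omega), smul_zero]
    · have hj : d + (j : ℕ) = i + (d + j - i) := by omega
      change translate u r i * translate u r j = 0
      rw [← translate_add_self hu r j, hj, translate_mul_translate_add,
        hr _ (by omega) (by omega), smul_zero]
  · rw [Fin.sum_univ_eq_sum_range (translate u r), hsum]

namespace IsShiftResolution

theorem val_pow_eq_one (h : IsShiftResolution d u r) : (u : R) ^ d = 1 := by
  rw [← Units.val_pow_eq_pow_val, h.pow_eq_one, Units.val_one]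

theorem sum_translate (h : IsShiftResolution d u r) : ∑ j ∈ range d, translate u r j = 1 := by
  rw [← Fin.sum_univ_eq_sum_range (translate u r), h.complete.complete]

theorem mul_translate (h : IsShiftResolution d u r) {j : ℕ} (hj : j < d) :
    r * translate u r j = if j = 0 then r else 0 := by
  classical
  have := h.complete.mul_eq ⟨0, by omega⟩ ⟨j, hj⟩
  simpa only [translate_zero, Fin.mk.injEq, eq_comm (a := 0)] using this

theorem mul_self (h : IsShiftResolution d u r) (hd : d ≠ 0) : r * r = r := by
  simpa only [translate_zero, if_true] using h.mul_translate (Nat.pos_of_ne_zero hd)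

theorem mul_pow_mul (h : IsShiftResolution d u r) {j : ℕ} (hj : j < d) :
    r * (u : R) ^ j * r = if j = 0 then r else 0 := by
  rw [mul_assoc, ← translate_mul_pow, ← mul_assoc, h.mul_translate hj]
  split_ifs with hj0 <;> simp [hj0]

end IsShiftResolution

variable [Algebra ℂ R]

theorem one_sub_smul_mul_one_sub_smul {y z : R} (hyz : y * z = 0) (c : ℂ) :
    (1 - c • y) * (1 - c • z) = 1 - c • (y + z) := by
  simp only [mul_sub, sub_mul, one_mul, mul_one, smul_mul_smul_comm, hyz, smul_zero, smul_add]
  abel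

/-- The operator that acts on the `j`-th summand of a shift resolution as the scalar `q ^ j`. -/
def gauge (d : ℕ) (u : Rˣ) (r : R) (q : ℂ) : R := ∑ j : Fin d, q ^ (j : ℕ) • translate u r j

/-- The conjugate of `u` by `gauge d u r p`, in closed form. On the `d` summands of the shift
resolution it acts as `p • u`, up to a phase on the last one that makes its order divide `d`. -/
def twistedShift (d : ℕ) (u : Rˣ) (r : R) (p : ℂ) : R := p • ((1 - (1 - (p ^ d)⁻¹) • r) * u)

theorem twistedShift_one (d : ℕ) (u : Rˣ) (r : R) : twistedShift d u r 1 = u := by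
  simp [twistedShift]

namespace IsShiftResolution

theorem gauge_mul_gauge (h : IsShiftResolution d u r) (p q : ℂ) :
    gauge d u r p * gauge d u r q = gauge d u r (p * q) := by
  simp only [gauge, sum_smul_mul_sum_smul h.complete.toOrthogonalIdempotents, mul_pow]

theorem gauge_mul_gauge_inv (h : IsShiftResolution d u r) {q : ℂ} (hq : q ≠ 0) :
    gauge d u r q * gauge d u r q⁻¹ = 1 := by
  rw [h.gauge_mul_gauge, mul_inv_cancel₀ hq, gauge]
  simpa only [one_pow, one_smul] using h.complete.complete

theorem mul_gauge (h : IsShiftResolution d u r) (hd : d ≠ 0) (q : ℂ) : r * gauge d u r q = r := by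
  have hterm : ∀ j ∈ range d, r * q ^ j • translate u r j = if j = 0 then r else 0 := fun j hj => by
    rw [mul_smul_comm, h.mul_translate (mem_range.1 hj)]
    split_ifs with hj0 <;> simp [hj0]
  rw [gauge, Fin.sum_univ_eq_sum_range (fun j => q ^ j • translate u r j), mul_sum,
    sum_congr rfl hterm, sum_ite_eq' (range d) 0, if_pos (mem_range.2 (by omega))]

theorem smul_gauge (h : IsShiftResolution d u r) (q : ℂ) :
    q • ConjAct.toConjAct u • gauge d u r q = gauge d u r q + (q ^ d - 1) • r := by
  have hd : translate u r d = r := by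
    rw [← add_zero d, translate_add_self h.pow_eq_one, translate_zero]
  have hsucc : ∀ j ∈ range d, q • ConjAct.toConjAct u • q ^ j • translate u r j
      = q ^ (j + 1) • translate u r (j + 1) := fun j _ => by
    rw [smul_comm (ConjAct.toConjAct u), ← translate_succ, smul_smul, ← pow_succ']
  have hshift := sum_range_succ' (fun j => q ^ j • translate u r j) d
  rw [sum_range_succ, hd, pow_zero, one_smul, translate_zero] at hshift
  rw [gauge, Fin.sum_univ_eq_sum_range (fun j => q ^ j • translate u r j), smul_sum, smul_sum,
    sum_congr rfl hsucc, sub_smul, one_smul, ← add_sub_assoc, hshift, add_sub_cancel_right]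

theorem semiconjBy_gauge (h : IsShiftResolution d u r) (hd : d ≠ 0) {p : ℂ} (hp : p ≠ 0) :
    SemiconjBy (gauge d u r p) (u : R) (twistedShift d u r p) := by
  have hpd : p ^ d ≠ 0 := pow_ne_zero d hp
  have hgauge : (1 - (1 - (p ^ d)⁻¹) • r) * (gauge d u r p + (p ^ d - 1) • r) = gauge d u r p := by
    simp only [sub_mul, one_mul, mul_add, smul_mul_assoc, mul_smul_comm, h.mul_gauge hd,
      h.mul_self hd]
    match_scalars
    · ring
    · field_simp
      ring
  rw [SemiconjBy, twistedShift, smul_mul_assoc, mul_assoc, units_mul_eq_smul_mul, ← mul_assoc,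
    ← smul_mul_assoc, ← mul_smul_comm, h.smul_gauge, hgauge]

theorem twistedShift_pow_self (h : IsShiftResolution d u r) (hd : d ≠ 0) {p : ℂ} (hp : p ≠ 0) :
    twistedShift d u r p ^ d = 1 := by
  have hconj := ((h.semiconjBy_gauge hd hp).pow_right d).eq
  rw [h.val_pow_eq_one, mul_one] at hconj
  rw [← mul_one (twistedShift d u r p ^ d), ← h.gauge_mul_gauge_inv hp, ← mul_assoc, ← hconj]

theorem spectralProj_twistedShift (h : IsShiftResolution d u r) {p : ℂ} (hp : p ≠ 0) (a : Fin d) :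
    spectralProj d (twistedShift d u r p) a
      = gauge d u r p * spectralProj d (u : R) a * gauge d u r p⁻¹ := by
  rw [(semiconjBy_spectralProj (h.semiconjBy_gauge (Fin.pos a).ne' hp) a).eq, mul_assoc,
    h.gauge_mul_gauge_inv hp, mul_one]

theorem spectralProj_mul_gauge_mul_spectralProj (h : IsShiftResolution d u r) (q : ℂ)
    (a b : Fin d) :
    spectralProj d (u : R) a * gauge d u r q * spectralProj d (u : R) b
      = (∑ j ∈ range d, (q * (omegaPow d a * (omegaPow d b)⁻¹)) ^ j) •
        (spectralProj d (u : R) a * r * spectralProj d (u : R) b) := by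
  have hu := h.val_pow_eq_one
  have hterm (j : ℕ) : spectralProj d (u : R) a * translate u r j * spectralProj d (u : R) b
      = (omegaPow d a * (omegaPow d b)⁻¹) ^ j •
        (spectralProj d (u : R) a * r * spectralProj d (u : R) b) := by
    have hb : spectralProj d (u : R) b
        = (omegaPow d b)⁻¹ ^ j • ((u : R) ^ j * spectralProj d (u : R) b) := by
      rw [pow_mul_spectralProj hu, smul_smul, inv_pow,
        inv_mul_cancel₀ (pow_ne_zero j (omegaPow_ne_zero d b)), one_smul]
    conv_lhs => rw [hb]
    rw [mul_smul_comm, ← mul_assoc, mul_assoc _ (translate u r j), translate_mul_pow, ← mul_assoc,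
      spectralProj_mul_pow hu, smul_mul_assoc, smul_mul_assoc, smul_smul, ← mul_pow, mul_comm]
  simp only [gauge, Fin.sum_univ_eq_sum_range (fun j => q ^ j • translate u r j), mul_sum, sum_mul,
    mul_smul_comm, smul_mul_assoc, hterm, smul_smul, sum_smul, mul_pow]

theorem mul_spectralProj_mul (h : IsShiftResolution d u r) (a : Fin d) :
    r * spectralProj d (u : R) a * r = (d : ℂ)⁻¹ • r := by
  have hterm : ∀ k ∈ range d, r * ((omegaPow d a)⁻¹ • (u : R)) ^ k * r
      = if k = 0 then r else 0 := fun k hk => by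
    rw [smul_pow, mul_smul_comm, smul_mul_assoc, h.mul_pow_mul (mem_range.1 hk)]
    split_ifs with hk0 <;> simp [hk0]
  rw [spectralProj, mul_smul_comm, smul_mul_assoc, mul_sum, sum_mul, sum_congr rfl hterm,
    sum_ite_eq' (range d) 0, if_pos (mem_range.2 (Fin.pos a))]

theorem twistedShift_pow (h : IsShiftResolution d u r) (p : ℂ) {k : ℕ} (hk : k ≤ d) :
    twistedShift d u r p ^ k
      = p ^ k • ((1 - (1 - (p ^ d)⁻¹) • ∑ j ∈ range k, translate u r j) * (u : R) ^ k) := by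
  induction k with
  | zero => simp
  | succ k ih =>
    set c := 1 - (p ^ d)⁻¹
    set S := ∑ j ∈ range k, translate u r j
    have hshift : ConjAct.toConjAct u • S = ∑ j ∈ range k, translate u r (j + 1) := by
      simp only [S, smul_sum, ← translate_succ]
    have horth : r * ConjAct.toConjAct u • S = 0 := by
      rw [hshift, mul_sum]
      refine sum_eq_zero fun j hj => ?_
      rw [h.mul_translate (by have := mem_range.1 hj; omega), if_neg j.succ_ne_zero]
    have hsum : ∑ j ∈ range (k + 1), translate u r j = r + ConjAct.toConjAct u • S := by
      rw [sum_range_succ', translate_zero, hshift, add_comm]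
    have hmul : (1 - c • r) * (ConjAct.toConjAct u • (1 - c • S))
        = 1 - c • (r + ConjAct.toConjAct u • S) := by
      rw [smul_sub, smul_one, smul_comm (ConjAct.toConjAct u), one_sub_smul_mul_one_sub_smul horth]
    rw [pow_succ', ih (by omega), twistedShift, smul_mul_smul_comm, ← pow_succ', mul_assoc,
      ← mul_assoc (u : R), units_mul_eq_smul_mul, mul_assoc _ (u : R), ← pow_succ', ← mul_assoc,
      hmul, hsum]

section Trace

variable {τ : R →ₗ[ℂ] ℂ}

theorem trace_eq_div (h : IsShiftResolution d u r) (hd : d ≠ 0)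
    (hτ : ∀ x y, τ (x * y) = τ (y * x)) : τ r = τ 1 / d := by
  have htranslate : ∀ j ∈ range d, τ (translate u r j) = τ r := fun j _ => by
    rw [translate, ← map_pow, ConjAct.units_smul_def, hτ, ← mul_assoc, ConjAct.ofConjAct_toConjAct,
      Units.inv_mul, one_mul]
  rw [eq_div_iff (Nat.cast_ne_zero.2 hd), ← h.sum_translate, map_sum, sum_congr rfl htranslate,
    sum_const, card_range, nsmul_eq_mul, mul_comm]

theorem trace_mul_spectralProj_mul_spectralProj (h : IsShiftResolution d u r)
    (hτ : ∀ x y, τ (x * y) = τ (y * x)) (a b : Fin d) :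
    τ (r * (spectralProj d (u : R) a * r * spectralProj d (u : R) b))
      = τ 1 / d * ((d : ℂ) ^ 2)⁻¹ := by
  have hd : d ≠ 0 := (Fin.pos a).ne'
  have hb : τ (r * spectralProj d (u : R) b) = (d : ℂ)⁻¹ * τ r := by
    rw [← h.mul_self hd, mul_assoc, hτ, h.mul_spectralProj_mul, map_smul, smul_eq_mul,
      h.mul_self hd]
  rw [← mul_assoc, ← mul_assoc, h.mul_spectralProj_mul, smul_mul_assoc, map_smul, smul_eq_mul, hb,
    h.trace_eq_div hd hτ]
  ring

theorem trace_spectralProj_mul_spectralProj (h : IsShiftResolution d u r)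
    (hτ : ∀ x y, τ (x * y) = τ (y * x)) (s t : ℝ) (a b : Fin d) :
    τ (spectralProj d (twistedShift d u r (omegaPow d s)) a
        * spectralProj d (twistedShift d u r (omegaPow d t)) b)
      = τ 1 / d * fejerKernel d ((b - t) - (a - s)) := by
  set z : ℝ := (t - s) + (a - b)
  have hz : omegaPow d z = (omegaPow d s)⁻¹ * omegaPow d t * (omegaPow d a * (omegaPow d b)⁻¹) := by
    rw [omegaPow_add, omegaPow_sub, omegaPow_sub, mul_comm (omegaPow d t)]
  have hz' : (omegaPow d z)⁻¹
      = (omegaPow d t)⁻¹ * omegaPow d s * (omegaPow d b * (omegaPow d a)⁻¹) := by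
    rw [← omegaPow_neg, show -z = (s - t) + (b - a) by ring, omegaPow_add, omegaPow_sub,
      omegaPow_sub, mul_comm (omegaPow d s)]
  set E := spectralProj d (u : R) a
  set F := spectralProj d (u : R) b
  have hcycle : τ (spectralProj d (twistedShift d u r (omegaPow d s)) a
        * spectralProj d (twistedShift d u r (omegaPow d t)) b)
      = τ (E * gauge d u r ((omegaPow d s)⁻¹ * omegaPow d t) * F
        * gauge d u r ((omegaPow d t)⁻¹ * omegaPow d s)) := by
    rw [h.spectralProj_twistedShift (omegaPow_ne_zero d s),
      h.spectralProj_twistedShift (omegaPow_ne_zero d t), mul_assoc (gauge d u r _), mul_assoc, hτ,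
      ← h.gauge_mul_gauge, ← h.gauge_mul_gauge]
    simp only [mul_assoc, E, F]
  rw [hcycle, h.spectralProj_mul_gauge_mul_spectralProj, ← hz, smul_mul_assoc, map_smul,
    mul_assoc, mul_assoc, hτ, mul_assoc r, h.spectralProj_mul_gauge_mul_spectralProj, ← hz',
    mul_smul_comm, map_smul, h.trace_mul_spectralProj_mul_spectralProj hτ,
    show (b - t : ℝ) - (a - s) = -z by ring, fejerKernel_neg, ofReal_fejerKernel, smul_eq_mul,
    smul_eq_mul]
  ring

end Trace

end IsShiftResolution

end ShiftResolutions

section ShiftResolutionCriterion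

variable {R : Type*} [Ring R] [Algebra ℂ R] {d : ℕ} {u : Rˣ}

theorem mul_eq_zero_and_eq_add_of_one_sub_smul {x y z : R} {b c : ℂ} (hb : b ≠ 0) (hc : c ≠ 0)
    (hbc : b ≠ c) (h₁ : 1 - b • x = (1 - b • y) * (1 - b • z))
    (h₂ : 1 - c • x = (1 - c • y) * (1 - c • z)) : y * z = 0 ∧ x = y + z := by
  have expand {b : ℂ} (hb : b ≠ 0) (h : 1 - b • x = (1 - b • y) * (1 - b • z)) :
      x = y + z - b • (y * z) := by
    simp only [mul_sub, sub_mul, one_mul, mul_one, smul_mul_smul_comm] at h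
    refine smul_right_injective R hb ?_
    simp only [smul_sub, smul_add, smul_smul]
    linear_combination (norm := module) -h
  have hx₁ := expand hb h₁
  have hx₂ := expand hc h₂
  have hyz : (c - b) • (y * z) = 0 := by
    rw [sub_smul]
    linear_combination (norm := module) hx₂ - hx₁
  have hyz0 := (smul_eq_zero_iff_right (sub_ne_zero.2 hbc.symm)).1 hyz
  exact ⟨hyz0, by rw [hx₁, hyz0, smul_zero, sub_zero]⟩

theorem one_sub_smul_cocycle {X : R} {p c : ℂ} (hp : p ≠ 0) {Q : ℕ → R}
    (hX : ∀ k ≤ d, X ^ k = p ^ k • ((1 - c • Q k) * (u : R) ^ k)) {k : ℕ} (hk : k < d) :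
    1 - c • Q (k + 1) = (1 - c • Q 1) * (1 - c • (ConjAct.toConjAct u • Q k)) := by
  have h := hX (k + 1) hk
  have h₁ := hX 1 (by omega)
  rw [pow_one, pow_one, pow_one] at h₁
  rw [pow_succ', hX k hk.le, h₁, smul_mul_smul_comm, ← pow_succ', mul_assoc, ← mul_assoc (u : R),
    units_mul_eq_smul_mul, mul_assoc _ (u : R), ← pow_succ', ← mul_assoc, smul_sub, smul_one,
    smul_comm (ConjAct.toConjAct u), ← Units.val_pow_eq_pow_val] at h
  exact ((Units.mul_left_inj _).1 (smul_right_injective R (pow_ne_zero _ hp) h)).symm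

theorem isShiftResolution_of_pow_eq (hu : u ^ d = 1) {B C : R} {p q b c : ℂ}
    (hp : p ≠ 0) (hq : q ≠ 0) (hb : b ≠ 0) (hc : c ≠ 0) (hbc : b ≠ c) {Q : ℕ → R}
    (hB : ∀ k ≤ d, B ^ k = p ^ k • ((1 - b • Q k) * (u : R) ^ k))
    (hC : ∀ k ≤ d, C ^ k = q ^ k • ((1 - c • Q k) * (u : R) ^ k))
    (hQd : Q d = 1) : IsShiftResolution d u (Q 1) := by
  have hcocycle {k : ℕ} (hk : k < d) :
      Q 1 * (ConjAct.toConjAct u • Q k) = 0 ∧ Q (k + 1) = Q 1 + ConjAct.toConjAct u • Q k :=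
    mul_eq_zero_and_eq_add_of_one_sub_smul hb hc hbc (one_sub_smul_cocycle hp hB hk)
      (one_sub_smul_cocycle hq hC hk)
  have hQ0 : Q 0 = 0 := by
    have h := hB 0 d.zero_le
    rw [pow_zero, pow_zero, pow_zero, one_smul, mul_one, eq_comm, sub_eq_self] at h
    exact (smul_eq_zero_iff_right hb).1 h
  have hQ : ∀ k ≤ d, Q k = ∑ j ∈ range k, translate u (Q 1) j := fun k => by
    induction k with
    | zero => simp [hQ0]
    | succ k ih =>
      intro hk
      rw [(hcocycle (by omega)).2, ih (by omega), smul_sum, sum_range_succ', translate_zero,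
        add_comm]
      simp only [translate_succ]
  refine isShiftResolution_of_mul_translate_eq_zero hu (fun j hj hjd => ?_)
    (by rw [← hQ d le_rfl, hQd])
  obtain ⟨j, rfl⟩ : ∃ i, j = i + 1 := ⟨j - 1, by omega⟩
  have h := (hcocycle hjd).1
  rwa [hQ _ hjd.le, sum_range_succ, ← hQ _ (by omega), smul_add, mul_add,
    (hcocycle (by omega)).1, zero_add, ← translate_succ] at h

end ShiftResolutionCriterion

section Unitary

variable {R : Type*} [Ring R] [StarRing R] [Algebra ℂ R] [StarModule ℂ R]

theorem one_sub_smul_mem_unitary {r : R} (hr : IsStarProjection r) {c : ℂ} (hc : ‖1 - c‖ = 1) :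
    1 - c • r ∈ unitary R := by
  have hcc : conj (1 - c) * (1 - c) = 1 := by rw [Complex.conj_mul', hc]; norm_num
  have hstar : star (1 - c • r) = 1 - conj c • r := by
    rw [star_sub, star_one, star_smul, hr.isSelfAdjoint.star_eq, starRingEnd_apply]
  rw [map_sub, map_one] at hcc
  rw [Unitary.mem_iff, hstar]
  constructor <;>
  · simp only [mul_sub, sub_mul, one_mul, mul_one, smul_mul_smul_comm, hr.isIdempotentElem.eq]
    match_scalars
    · norm_num
    · linear_combination hcc

theorem twistedShift_mem_unitary (d : ℕ) {u : Rˣ} {r : R} (hu : (u : R) ∈ unitary R)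
    (hr : IsStarProjection r) {p : ℂ} (hp : ‖p‖ = 1) : twistedShift d u r p ∈ unitary R := by
  have hpu : p ∈ unitary ℂ := by
    rw [Unitary.mem_iff_star_mul_self, ← starRingEnd_apply, Complex.conj_mul', hp]
    norm_num
  refine Unitary.smul_mem_of_mem hpu (mul_mem (one_sub_smul_mem_unitary hr ?_) hu)
  rw [sub_sub_cancel, norm_inv, norm_pow, hp, one_pow, inv_one]

end Unitary

/-! ### The combinations that define the third and fourth observables -/

section Combinations

variable {R : Type*} [Ring R] [Algebra ℂ R] {d : ℕ}

/-- The combination `a_k x + a_k^* y`, so that `M_d = combM d 1 Z_d T_d`. -/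
def combM (d k : ℕ) (x y : R) : R := coeff d k • x + conj (coeff d k) • y

/-- The combination `ω^k a_k^* x + a_k y`, so that `N_d = combN d 1 Z_d T_d`. -/
def combN (d k : ℕ) (x y : R) : R := (conj (coeff d k) * omegaPow d k) • x + coeff d k • y

theorem combM_self_smul (d k : ℕ) (x Q : R) :
    combM d k x (omegaPow d (1 / 2) ^ k • ((1 - (2 : ℂ) • Q) * x))
      = omegaPow d (1 / 4) ^ k • ((1 - (1 + Complex.I) • Q) * x) := by
  have h₀ := omegaPow_ne_zero d (k / 4)
  have h₁ : omegaPow d (1 / 4) ^ k = omegaPow d (k / 4) ^ 1 := omegaPow_pow_eq (by norm_num)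
  have h₂ : omegaPow d (1 / 2) ^ k = omegaPow d (k / 4) ^ 2 := omegaPow_pow_eq (by norm_num)
  rw [combM, conj_coeff, coeff_eq, h₁, h₂, sub_mul, sub_mul, one_mul, smul_mul_assoc,
    smul_mul_assoc]
  match_scalars
  · field_simp
    ring
  · field_simp

theorem combN_self_smul (d k : ℕ) (x Q : R) :
    combN d k x (omegaPow d (1 / 2) ^ k • ((1 - (2 : ℂ) • Q) * x))
      = omegaPow d (3 / 4) ^ k • ((1 - (1 - Complex.I) • Q) * x) := by
  have h₀ := omegaPow_ne_zero d (k / 4)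
  have h₂ : omegaPow d (1 / 2) ^ k = omegaPow d (k / 4) ^ 2 := omegaPow_pow_eq (by norm_num)
  have h₃ : omegaPow d (3 / 4) ^ k = omegaPow d (k / 4) ^ 3 := omegaPow_pow_eq (by norm_num)
  have h₄ : omegaPow d 1 ^ k = omegaPow d (k / 4) ^ 4 := omegaPow_pow_eq (by norm_num)
  rw [combN, conj_coeff, coeff_eq, omegaPow_natCast, h₂, h₃, h₄, sub_mul, sub_mul, one_mul,
    smul_mul_assoc, smul_mul_assoc]
  match_scalars
  · field_simp
    ring
  · field_simp

variable {u : Rˣ} {r : R}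

theorem IsShiftResolution.combM_pow (h : IsShiftResolution d u r) (hd : d ≠ 0) {k : ℕ}
    (hk : k ≤ d) :
    combM d k ((u : R) ^ k) (twistedShift d u r (omegaPow d (1 / 2)) ^ k)
      = twistedShift d u r (omegaPow d (1 / 4)) ^ k := by
  rw [h.twistedShift_pow _ hk, h.twistedShift_pow _ hk, one_sub_inv_omegaPow_half_pow_self hd,
    one_sub_inv_omegaPow_quarter_pow_self hd, combM_self_smul]

theorem IsShiftResolution.combN_pow (h : IsShiftResolution d u r) (hd : d ≠ 0) {k : ℕ}
    (hk : k ≤ d) :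
    combN d k ((u : R) ^ k) (twistedShift d u r (omegaPow d (1 / 2)) ^ k)
      = twistedShift d u r (omegaPow d (3 / 4)) ^ k := by
  rw [h.twistedShift_pow _ hk, h.twistedShift_pow _ hk, one_sub_inv_omegaPow_half_pow_self hd,
    one_sub_inv_omegaPow_three_quarters_pow_self hd, combN_self_smul]

theorem exists_isShiftResolution_of_pow_eq_combM (hd : d ≠ 0) (hu : u ^ d = 1) {B C : R}
    (hB : B ^ d = 1) (hC : C ^ d = 1)
    (hcomb : ∀ k, 0 < k → k < d → C ^ k = combM d k ((u : R) ^ k) (B ^ k)) :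
    ∃ r, IsShiftResolution d u r ∧ B = twistedShift d u r (omegaPow d (1 / 2)) := by
  have hp (k : ℕ) : omegaPow d (1 / 2) ^ k ≠ 0 := pow_ne_zero k (omegaPow_ne_zero d _)
  have hud : (u : R) ^ d = 1 := by rw [← Units.val_pow_eq_pow_val, hu, Units.val_one]
  set Q : ℕ → R := fun k =>
    (2 : ℂ)⁻¹ • (1 - (omegaPow d (1 / 2) ^ k)⁻¹ • (B ^ k * ↑(u ^ k)⁻¹)) with hQ
  have hBQ (k : ℕ) : B ^ k = omegaPow d (1 / 2) ^ k • ((1 - (2 : ℂ) • Q k) * (u : R) ^ k) := by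
    rw [hQ, smul_inv_smul₀ two_ne_zero, sub_sub_cancel, smul_mul_assoc, smul_inv_smul₀ (hp k),
      ← Units.val_pow_eq_pow_val, Units.inv_mul_cancel_right]
  have hQ0 : Q 0 = 0 := by simp [hQ]
  have hQd : Q d = 1 := by
    simp only [hQ, omegaPow_half_pow_self hd, hB, hu, inv_one, Units.val_one, mul_one]
    match_scalars
    norm_num
  have hCQ : ∀ k ≤ d, C ^ k
      = omegaPow d (1 / 4) ^ k • ((1 - (1 + Complex.I) • Q k) * (u : R) ^ k) := fun k hk => by
    rcases k.eq_zero_or_pos with rfl | hk0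
    · simp [hQ0]
    rcases hk.eq_or_lt with rfl | hkd
    · rw [hC, hQd, hud, omegaPow_quarter_pow_self hd, mul_one]
      match_scalars
      linear_combination Complex.I_sq
    · rw [hcomb k hk0 hkd, hBQ, combM_self_smul]
  have hI0 : 1 + Complex.I ≠ 0 := fun h => by simpa using congrArg Complex.re h
  have hI2 : 2 ≠ 1 + Complex.I := fun h => by simpa using congrArg Complex.im h
  have hres := isShiftResolution_of_pow_eq hu (omegaPow_ne_zero d _) (omegaPow_ne_zero d _)
    two_ne_zero hI0 hI2 (fun k _ => hBQ k) hCQ hQd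
  refine ⟨Q 1, hres, ?_⟩
  have hB1 := hBQ 1
  rw [pow_one, pow_one, pow_one] at hB1
  rw [twistedShift, one_sub_inv_omegaPow_half_pow_self hd, hB1]

end Combinations

/-! ### Repeatable measurements are projective -/

section HilbertSchmidt

open scoped ComplexOrder

variable {n : Type*} [Fintype n]

/-- The square of the Hilbert-Schmidt norm, `Tr (X Xᴴ)`. -/
def hsNormSq (X : Matrix n n ℂ) : ℝ := (X * Xᴴ).trace.re

theorem trace_mul_conjTranspose_nonneg (X : Matrix n n ℂ) : 0 ≤ (X * Xᴴ).trace :=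
  (Matrix.posSemidef_self_mul_conjTranspose X).trace_nonneg

theorem hsNormSq_nonneg (X : Matrix n n ℂ) : 0 ≤ hsNormSq X :=
  (Complex.nonneg_iff.1 (trace_mul_conjTranspose_nonneg X)).1

theorem ofReal_hsNormSq (X : Matrix n n ℂ) : (hsNormSq X : ℂ) = (X * Xᴴ).trace :=
  Complex.ext rfl (Complex.nonneg_iff.1 (trace_mul_conjTranspose_nonneg X)).2

theorem hsNormSq_eq_zero {X : Matrix n n ℂ} : hsNormSq X = 0 ↔ X = 0 := by
  rw [← Complex.ofReal_eq_zero, ofReal_hsNormSq, Matrix.trace_mul_conjTranspose_self_eq_zero_iff]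

theorem hsNormSq_eq_trace_conjTranspose_mul (X : Matrix n n ℂ) :
    hsNormSq X = (Xᴴ * X).trace.re := by
  rw [hsNormSq, Matrix.trace_mul_comm]

theorem hsNormSq_sub (X Y : Matrix n n ℂ) :
    hsNormSq (X - Y) = hsNormSq X - 2 * (Y * Xᴴ).trace.re + hsNormSq Y := by
  have h : (X * Yᴴ).trace.re = (Y * Xᴴ).trace.re := by
    rw [← Complex.conj_re, starRingEnd_apply, ← Matrix.trace_conjTranspose,
      Matrix.conjTranspose_mul, Matrix.conjTranspose_conjTranspose]
  simp only [hsNormSq, Matrix.conjTranspose_sub, sub_mul, mul_sub, Matrix.trace_sub,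
    Complex.sub_re, h]
  ring

theorem hsNormSq_of_mem_unitary [DecidableEq n] {U : Matrix n n ℂ}
    (hU : U ∈ unitary (Matrix n n ℂ)) : hsNormSq U = Fintype.card n := by
  rw [hsNormSq, ← Matrix.star_eq_conjTranspose, hU.2, Matrix.trace_one, Complex.natCast_re]

end HilbertSchmidt

section Measurements

variable {d D : ℕ}

/-- The POVM element `Kᴴ K` of an outcome. -/
def effect (A : Measurement d D) (a : Fin d) : Matrix (Fin D) (Fin D) ℂ :=
  (A.kraus a)ᴴ * A.kraus a

theorem conjTranspose_effect (A : Measurement d D) (a : Fin d) : (effect A a)ᴴ = effect A a := by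
  rw [effect, Matrix.conjTranspose_mul, Matrix.conjTranspose_conjTranspose]

theorem trace_effect_mul_effect (A B : Measurement d D) (a b : Fin d) :
    (effect A a * effect B b).trace = hsNormSq (B.kraus b * (A.kraus a)ᴴ) := by
  rw [ofReal_hsNormSq, effect, effect, Matrix.conjTranspose_mul,
    Matrix.conjTranspose_conjTranspose, ← mul_assoc, Matrix.trace_mul_comm]
  simp only [mul_assoc]

theorem prob_eq (A : Measurement d D) (a : Fin d) :
    prob A a = (D : ℝ)⁻¹ * hsNormSq (A.kraus a) := by
  rw [prob, postState, maximallyMixed, mul_smul_comm, mul_one, smul_mul_assoc, Matrix.trace_smul,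
    smul_eq_mul, ← Complex.ofReal_natCast, ← Complex.ofReal_inv, Complex.re_ofReal_mul, hsNormSq]

theorem jointProb_eq (A B : Measurement d D) (a b : Fin d) :
    jointProb A B a b = (D : ℝ)⁻¹ * hsNormSq (B.kraus b * A.kraus a) := by
  rw [jointProb, postState, maximallyMixed, mul_smul_comm, mul_one, smul_mul_assoc, mul_smul_comm,
    smul_mul_assoc, Matrix.trace_smul, smul_eq_mul, ← Complex.ofReal_natCast, ← Complex.ofReal_inv,
    Complex.re_ofReal_mul, hsNormSq, Matrix.conjTranspose_mul]
  simp only [mul_assoc]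

theorem jointProb_nonneg (A B : Measurement d D) (a b : Fin d) : 0 ≤ jointProb A B a b := by
  rw [jointProb_eq]
  exact mul_nonneg (by positivity) (hsNormSq_nonneg _)

theorem isRepeatable_of_isIdempotentElem {A : Measurement d D}
    (hA : ∀ a, IsIdempotentElem (A.kraus a)) : IsRepeatable A := fun a => by
  rw [jointProb_eq, prob_eq, (hA a).eq]

theorem hsNormSq_effect_le (A : Measurement d D) (a : Fin d) :
    hsNormSq (effect A a) ≤ (effect A a).trace.re := by
  have h : (effect A a).trace.re = ∑ b, hsNormSq (A.kraus b * (A.kraus a)ᴴ) := by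
    rw [← Complex.ofReal_re (∑ b, _), Complex.ofReal_sum]
    simp only [← trace_effect_mul_effect A A a]
    rw [← Matrix.trace_sum, ← mul_sum]
    simp only [effect]
    rw [A.complete, mul_one]
  rw [h, ← Complex.ofReal_re (hsNormSq (effect A a)), ofReal_hsNormSq, conjTranspose_effect,
    trace_effect_mul_effect, Complex.ofReal_re]
  exact single_le_sum (f := fun b => hsNormSq (A.kraus b * (A.kraus a)ᴴ))
    (fun b _ => hsNormSq_nonneg _) (mem_univ a)

namespace IsRepeatable

variable {A B : Measurement d D}

theorem kraus_mul_kraus (hA : IsRepeatable A) {a b : Fin d} (hab : a ≠ b) :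
    A.kraus b * A.kraus a = 0 := by
  rcases D.eq_zero_or_pos with rfl | hD
  · exact Subsingleton.elim _ _
  have hsum := sum_jointProb A A a
  rw [← add_sum_erase _ _ (mem_univ a), hA a, add_eq_left,
    sum_eq_zero_iff_of_nonneg fun b _ => jointProb_nonneg A A a b] at hsum
  have hab0 := hsum b (mem_erase.2 ⟨hab.symm, mem_univ b⟩)
  rw [jointProb_eq] at hab0
  exact hsNormSq_eq_zero.1 ((mul_eq_zero.1 hab0).resolve_left (by positivity))

theorem effect_mul_kraus (hA : IsRepeatable A) (a : Fin d) :
    effect A a * A.kraus a = A.kraus a := by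
  have h : (∑ b, effect A b) * A.kraus a = A.kraus a := by
    simp only [effect]
    rw [A.complete, one_mul]
  rwa [sum_mul, sum_eq_single a (fun b _ hb => by
    rw [effect, mul_assoc, hA.kraus_mul_kraus hb.symm, mul_zero]) (by simp)] at h

/- The effect `E = Kᴴ K` fixes the range of `F = K Kᴴ`, so `‖F - E‖² = 2 (Tr E² - Tr E) ≤ 0`. -/
theorem kraus_mul_conjTranspose (hA : IsRepeatable A) (a : Fin d) :
    A.kraus a * (A.kraus a)ᴴ = effect A a := by
  set K := A.kraus a with hK
  have hself : (K * Kᴴ)ᴴ = K * Kᴴ := by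
    rw [Matrix.conjTranspose_mul, Matrix.conjTranspose_conjTranspose]
  have hcross : (effect A a * (K * Kᴴ)ᴴ).trace = (effect A a).trace := by
    rw [hself, ← mul_assoc, hA.effect_mul_kraus, Matrix.trace_mul_comm, effect]
  have hnorm : hsNormSq (K * Kᴴ) = hsNormSq (effect A a) := by
    rw [hsNormSq, hsNormSq, hself, conjTranspose_effect, effect, mul_assoc,
      Matrix.trace_mul_comm, mul_assoc, mul_assoc, ← hK]
    simp only [mul_assoc]
  refine sub_eq_zero.1 (hsNormSq_eq_zero.1 (le_antisymm ?_ (hsNormSq_nonneg _)))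
  rw [hsNormSq_sub, hcross, hnorm]
  linarith [hsNormSq_effect_le A a]

theorem completeOrthogonalIdempotents_effect (hA : IsRepeatable A) :
    CompleteOrthogonalIdempotents (effect A) := by
  refine CompleteOrthogonalIdempotents.iff_ortho_complete.2 ⟨fun a b hab => ?_, A.complete⟩
  change effect A a * effect A b = 0
  rw [← hA.kraus_mul_conjTranspose b, effect, mul_assoc, ← mul_assoc (A.kraus a),
    hA.kraus_mul_kraus hab.symm, zero_mul, mul_zero]

theorem jointProb_eq_trace (hA : IsRepeatable A) (B : Measurement d D) (a b : Fin d) :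
    (jointProb A B a b : ℂ) = (D : ℂ)⁻¹ * (effect A a * effect B b).trace := by
  rw [jointProb_eq, Complex.ofReal_mul, Complex.ofReal_inv, Complex.ofReal_natCast,
    ofReal_hsNormSq, ← hA.kraus_mul_conjTranspose, effect, Matrix.conjTranspose_mul,
    Matrix.trace_mul_comm (_ * _ᴴ), mul_assoc (_ᴴ), Matrix.trace_mul_comm (_ᴴ)]
  simp only [mul_assoc]

end IsRepeatable

/-- The unitary observable `∑ ω ^ a E_a` of a measurement with POVM elements `E_a`. -/
def observable (A : Measurement d D) : Matrix (Fin D) (Fin D) ℂ :=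
  ∑ a : Fin d, omegaPow d a • effect A a

namespace IsRepeatable

variable {A B : Measurement d D}

theorem observable_pow (hA : IsRepeatable A) (k : ℕ) :
    observable A ^ k = ∑ a : Fin d, omegaPow d a ^ k • effect A a :=
  sum_smul_pow hA.completeOrthogonalIdempotents_effect _ k

theorem observable_pow_self (hA : IsRepeatable A) (hd : d ≠ 0) : observable A ^ d = 1 := by
  simp only [hA.observable_pow, omegaPow_natCast_pow_self hd, one_smul,
    hA.completeOrthogonalIdempotents_effect.complete]

theorem observable_mem_unitary (hA : IsRepeatable A) :
    observable A ∈ unitary (Matrix (Fin D) (Fin D) ℂ) := by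
  have hE := hA.completeOrthogonalIdempotents_effect
  have hstar : star (observable A) = ∑ a : Fin d, (omegaPow d a)⁻¹ • effect A a := by
    simp only [observable, star_sum, star_smul, ← starRingEnd_apply, conj_omegaPow,
      Matrix.star_eq_conjTranspose, conjTranspose_effect]
  rw [Unitary.mem_iff, hstar, observable, sum_smul_mul_sum_smul hE.toOrthogonalIdempotents,
    sum_smul_mul_sum_smul hE.toOrthogonalIdempotents]
  simp only [inv_mul_cancel₀ (omegaPow_ne_zero d _), mul_inv_cancel₀ (omegaPow_ne_zero d _),
    one_smul, hE.complete, and_self]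

theorem spectralProj_observable (hA : IsRepeatable A) (a : Fin d) :
    spectralProj d (observable A) a = effect A a :=
  spectralProj_sum_smul hA.completeOrthogonalIdempotents_effect a

theorem correlator_eq (hA : IsRepeatable A) (hB : IsRepeatable B) (k l : ℕ) :
    correlator A B k l = (D : ℂ)⁻¹ * (observable A ^ k * observable B ^ l).trace := by
  rw [hA.observable_pow, hB.observable_pow, sum_mul_sum, Matrix.trace_sum, mul_sum, correlator]
  refine sum_congr rfl fun a _ => ?_
  rw [Matrix.trace_sum, mul_sum]
  refine sum_congr rfl fun b _ => ?_
  rw [hA.jointProb_eq_trace, omegaPow_add, mul_comm (a : ℝ), mul_comm (b : ℝ),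
    omegaPow_natCast_mul, omegaPow_natCast_mul, smul_mul_smul_comm, Matrix.trace_smul,
    smul_eq_mul]
  ring

end IsRepeatable

end Measurements

/-! ### The temporal expression as a sum of squares -/

theorem star_combM_mul_combM_add {R : Type*} [Ring R] [StarRing R] [Algebra ℂ R] [StarModule ℂ R]
    (d k : ℕ) {x y : R} (hx : x ∈ unitary R) (hy : y ∈ unitary R) :
    star (combM d k x y) * combM d k x y + star (combN d k x y) * combN d k x y = (2 : ℂ) • 1 := by
  have hω : conj (omegaPow d k) * omegaPow d k = 1 := by
    rw [conj_omegaPow, inv_mul_cancel₀ (omegaPow_ne_zero _ _)]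
  have hnorm : coeff d k * conj (coeff d k) = 1 / 2 := by
    rw [conj_coeff, coeff_eq]
    field_simp [omegaPow_ne_zero]
    linear_combination -Complex.I_sq
  have hcross : coeff d k * coeff d k + conj (coeff d k) * (conj (coeff d k) * omegaPow d k)
      = 0 := by
    have hk : omegaPow d k = omegaPow d (k / 4) ^ 4 := by
      rw [← omegaPow_natCast_mul]
      congr 1
      push_cast
      ring
    rw [conj_coeff, coeff_eq, hk]
    field_simp [omegaPow_ne_zero]
    linear_combination 2 * omegaPow d (k / 4) ^ 2 * Complex.I_sq
  have hcross' := congrArg conj hcross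
  simp only [map_add, map_mul, Complex.conj_conj, map_zero] at hcross'
  simp only [combM, combN, star_add, star_smul, add_mul, mul_add, smul_mul_smul_comm,
    ← starRingEnd_apply, map_mul, Complex.conj_conj, hx.1, hy.1]
  linear_combination (norm := module) (3 * hnorm + conj (omegaPow d k) * omegaPow d k * hnorm
    + 1 / 2 * hω) • (1 : R) + hcross • (star y * x) + hcross' • (star x * y)

section Strategies

variable {d D : ℕ} {A : Strategy d D}

/-- The sum of the squared distances of the `k`-th powers of the third and fourth observables from
the combinations of the first two that they are equal to in an optimal strategy. -/
def defect (A : Strategy d D) (k : ℕ) : ℝ :=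
  hsNormSq (observable (A 2) ^ k - combM d k (observable (A 0) ^ k) (observable (A 1) ^ k))
    + hsNormSq (observable (A 3) ^ k - combN d k (observable (A 0) ^ k) (observable (A 1) ^ k))

theorem defect_nonneg (A : Strategy d D) (k : ℕ) : 0 ≤ defect A k :=
  add_nonneg (hsNormSq_nonneg _) (hsNormSq_nonneg _)

theorem defect_eq_zero_iff {k : ℕ} : defect A k = 0 ↔
    observable (A 2) ^ k = combM d k (observable (A 0) ^ k) (observable (A 1) ^ k) ∧
      observable (A 3) ^ k = combN d k (observable (A 0) ^ k) (observable (A 1) ^ k) := by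
  rw [defect, add_eq_zero_iff_of_nonneg (hsNormSq_nonneg _) (hsNormSq_nonneg _), hsNormSq_eq_zero,
    hsNormSq_eq_zero, sub_eq_zero, sub_eq_zero]

theorem temporalValue_eq (hA : ∀ i, IsRepeatable (A i)) (hd : d ≠ 0) :
    temporalValue A = 2 * (D : ℂ)⁻¹ * ∑ k ∈ Icc 1 (d - 1),
      ((combM d k (observable (A 0) ^ k) (observable (A 1) ^ k) * (observable (A 2) ^ k)ᴴ).trace
        + (combN d k (observable (A 0) ^ k) (observable (A 1) ^ k)
            * (observable (A 3) ^ k)ᴴ).trace) := by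
  rw [temporalValue, mul_sum]
  refine sum_congr rfl fun k hk => ?_
  have hstar (i : Fin 4) : observable (A i) ^ (d - k) = (observable (A i) ^ k)ᴴ :=
    pow_sub_eq_star_pow ((hA i).observable_pow_self hd) (hA i).observable_mem_unitary
      (by have := mem_Icc.1 hk; omega)
  simp only [(hA _).correlator_eq (hA _), hstar]
  simp only [Matrix.trace_mul_comm (_ᴴ), combM, combN,
    add_mul, smul_mul_assoc, Matrix.trace_add, Matrix.trace_smul, smul_eq_mul]
  ring

theorem defect_eq (hA : ∀ i, IsRepeatable (A i)) (k : ℕ) :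
    defect A k = 4 * D
      - 2 * ((combM d k (observable (A 0) ^ k) (observable (A 1) ^ k)
            * (observable (A 2) ^ k)ᴴ).trace
        + (combN d k (observable (A 0) ^ k) (observable (A 1) ^ k)
            * (observable (A 3) ^ k)ᴴ).trace).re := by
  have hunitary (i : Fin 4) := pow_mem (hA i).observable_mem_unitary k
  have hcomb := congrArg (fun X => X.trace.re)
    (star_combM_mul_combM_add d k (hunitary 0) (hunitary 1))
  simp only [Matrix.star_eq_conjTranspose, Matrix.trace_add, Complex.add_re,
    ← hsNormSq_eq_trace_conjTranspose_mul, Matrix.trace_smul, Matrix.trace_one, Fintype.card_fin,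
    smul_eq_mul, Complex.mul_re, Complex.re_ofNat, Complex.im_ofNat, Complex.natCast_re] at hcomb
  rw [defect, hsNormSq_sub, hsNormSq_sub, hsNormSq_of_mem_unitary (hunitary 2),
    hsNormSq_of_mem_unitary (hunitary 3), Complex.add_re, Fintype.card_fin]
  linarith

theorem re_temporalValue (hA : ∀ i, IsRepeatable (A i)) (hD : D ≠ 0) (hd : d ≠ 0) :
    (temporalValue A).re = 4 * ((d : ℝ) - 1) - (D : ℝ)⁻¹ * ∑ k ∈ Icc 1 (d - 1), defect A k := by
  have hD' : (D : ℝ) ≠ 0 := Nat.cast_ne_zero.2 hD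
  have hscalar : 2 * (D : ℂ)⁻¹ = ((2 * (D : ℝ)⁻¹ : ℝ) : ℂ) := by push_cast; rfl
  rw [temporalValue_eq hA hd, hscalar, Complex.re_ofReal_mul, Complex.re_sum,
    sum_congr rfl fun k _ => defect_eq hA k, sum_sub_distrib, sum_const, ← mul_sum, Nat.card_Icc,
    nsmul_eq_mul, Nat.add_sub_cancel, Nat.cast_sub (by omega)]
  field_simp
  push_cast
  ring

theorem IsOptimal.defect_eq_zero (hA : IsOptimal A) (hd : d ≠ 0) {k : ℕ} (hk₀ : 0 < k)
    (hk : k < d) : defect A k = 0 := by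
  have hD : (D : ℝ)⁻¹ ≠ 0 := inv_ne_zero (Nat.cast_ne_zero.2 hA.dim_pos.ne')
  have hre : (temporalValue A).re = 4 * ((d : ℝ) - 1) := by
    rw [hA.value]
    simp
  rw [re_temporalValue hA.repeatable hA.dim_pos.ne' hd, sub_eq_self, mul_eq_zero_iff_left hD,
    sum_eq_zero_iff_of_nonneg fun k _ => defect_nonneg A k] at hre
  exact hre k (mem_Icc.2 ⟨hk₀, by omega⟩)

theorem isOptimal_of_defect_eq_zero (hA : ∀ i, IsRepeatable (A i)) (hD : 0 < D) (hd : d ≠ 0)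
    (h : ∀ k, 0 < k → k < d → defect A k = 0) : IsOptimal A := by
  refine ⟨hD, hA, ?_⟩
  have hD' : (D : ℂ) ≠ 0 := Nat.cast_ne_zero.2 hD.ne'
  have htrace (i : Fin 4) (k : ℕ) :
      (observable (A i) ^ k * (observable (A i) ^ k)ᴴ).trace = D := by
    rw [← Matrix.star_eq_conjTranspose, (pow_mem (hA i).observable_mem_unitary k).2,
      Matrix.trace_one, Fintype.card_fin]
  have hterm : ∀ k ∈ Icc 1 (d - 1),
      (combM d k (observable (A 0) ^ k) (observable (A 1) ^ k) * (observable (A 2) ^ k)ᴴ).trace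
        + (combN d k (observable (A 0) ^ k) (observable (A 1) ^ k)
            * (observable (A 3) ^ k)ᴴ).trace = D + D := fun k hk => by
    have hk' := mem_Icc.1 hk
    obtain ⟨hM, hN⟩ := defect_eq_zero_iff.1 (h k (by omega) (by omega))
    rw [← hM, ← hN, htrace, htrace]
  rw [temporalValue_eq hA hd, sum_congr rfl hterm, sum_const, Nat.card_Icc, nsmul_eq_mul,
    Nat.add_sub_cancel, Nat.cast_sub (by omega)]
  field_simp
  push_cast
  ring

end Strategies

/-! ### Classification of the optimal strategies -/

section Classification

/-- The exponents `s` for which the four observables of an optimal strategy are the twisted shifts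
by `ω ^ s` of one shift resolution. -/
def phaseExponent : Fin 4 → ℝ := ![0, 1 / 2, 1 / 4, 3 / 4]

/-- The probability of the outcome `b` of `A_j` given the outcome `a` of `A_i` in an optimal
strategy. -/
def optimalProb (d : ℕ) (i j : Fin 4) (a b : Fin d) : ℝ :=
  fejerKernel d ((b - phaseExponent j) - (a - phaseExponent i))

theorem optimalProb_self_self {d : ℕ} (i : Fin 4) (a : Fin d) : optimalProb d i i a a = 1 := by
  rw [optimalProb, sub_self, fejerKernel_zero (Fin.pos a).ne']

theorem optimalProb_self_of_ne {d : ℕ} (i : Fin 4) {a b : Fin d} (hab : a ≠ b) :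
    optimalProb d i i a b = 0 := by
  rw [optimalProb, sub_sub_sub_cancel_right, fejerKernel_sub_eq_zero hab]

section ShiftObservables

variable {R : Type*} [Ring R] [Algebra ℂ R] {d : ℕ} {u : Rˣ} {r : R}

/-- The four observables attached to a shift resolution. -/
def shiftObs (d : ℕ) (u : Rˣ) (r : R) (i : Fin 4) : R :=
  twistedShift d u r (omegaPow d (phaseExponent i))

theorem shiftObs_zero (d : ℕ) (u : Rˣ) (r : R) : shiftObs d u r 0 = u := by
  simp [shiftObs, phaseExponent, omegaPow_zero, twistedShift_one]

namespace IsShiftResolution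

theorem shiftObs_pow_self (h : IsShiftResolution d u r) (hd : d ≠ 0) (i : Fin 4) :
    shiftObs d u r i ^ d = 1 :=
  h.twistedShift_pow_self hd (omegaPow_ne_zero d _)

theorem shiftObs_two_pow (h : IsShiftResolution d u r) (hd : d ≠ 0) {k : ℕ} (hk : k ≤ d) :
    shiftObs d u r 2 ^ k = combM d k (shiftObs d u r 0 ^ k) (shiftObs d u r 1 ^ k) := by
  rw [shiftObs_zero]
  exact (h.combM_pow hd hk).symm

theorem shiftObs_three_pow (h : IsShiftResolution d u r) (hd : d ≠ 0) {k : ℕ} (hk : k ≤ d) :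
    shiftObs d u r 3 ^ k = combN d k (shiftObs d u r 0 ^ k) (shiftObs d u r 1 ^ k) := by
  rw [shiftObs_zero]
  exact (h.combN_pow hd hk).symm

theorem eq_shiftObs (h : IsShiftResolution d u r) (hd : d ≠ 0) {X : Fin 4 → R} (h₀ : X 0 = u)
    (h₁ : X 1 = shiftObs d u r 1) (h₂ : X 2 = combM d 1 (X 0) (X 1))
    (h₃ : X 3 = combN d 1 (X 0) (X 1)) : X = shiftObs d u r := by
  rw [← shiftObs_zero d u r] at h₀
  have hM := h.shiftObs_two_pow hd (Nat.one_le_iff_ne_zero.2 hd)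
  have hN := h.shiftObs_three_pow hd (Nat.one_le_iff_ne_zero.2 hd)
  rw [pow_one, pow_one, pow_one, ← h₀, ← h₁] at hM hN
  funext i
  fin_cases i
  exacts [h₀, h₁, h₂.trans hM.symm, h₃.trans hN.symm]

theorem trace_spectralProj_shiftObs_mul (h : IsShiftResolution d u r) {τ : R →ₗ[ℂ] ℂ}
    (hτ : ∀ x y, τ (x * y) = τ (y * x)) (i j : Fin 4) (a b : Fin d) :
    τ (spectralProj d (shiftObs d u r i) a * spectralProj d (shiftObs d u r j) b)
      = τ 1 / d * optimalProb d i j a b :=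
  h.trace_spectralProj_mul_spectralProj hτ _ _ a b

end IsShiftResolution

theorem trace_spectralProj_shiftObs_mul {n : Type*} [Fintype n] [DecidableEq n]
    {u : (Matrix n n ℂ)ˣ} {r : Matrix n n ℂ} (h : IsShiftResolution d u r) (i j : Fin 4)
    (a b : Fin d) :
    (spectralProj d (shiftObs d u r i) a * spectralProj d (shiftObs d u r j) b).trace
      = Fintype.card n / d * optimalProb d i j a b := by
  rw [← Matrix.trace_one (n := n) (R := ℂ)]
  exact h.trace_spectralProj_shiftObs_mul (τ := Matrix.traceLinearMap n ℂ ℂ)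
    Matrix.trace_mul_comm i j a b

end ShiftObservables

variable {d D : ℕ} {A : Strategy d D}

theorem IsOptimal.exists_isShiftResolution (hA : IsOptimal A) (hd : 1 < d) :
    ∃ u r, IsShiftResolution d u r ∧ ∀ i, observable (A i) = shiftObs d u r i := by
  have hd0 : d ≠ 0 := by omega
  have horder (i : Fin 4) := (hA.repeatable i).observable_pow_self hd0
  have hcomb {k : ℕ} (hk₀ : 0 < k) (hk : k < d) :=
    defect_eq_zero_iff.1 (hA.defect_eq_zero hd0 hk₀ hk)
  have hcomb₁ := hcomb one_pos hd
  simp only [pow_one] at hcomb₁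
  obtain ⟨r, hr, h₁⟩ := exists_isShiftResolution_of_pow_eq_combM
    (u := Units.ofPowEqOne (observable (A 0)) d (horder 0) hd0) hd0 (Units.pow_ofPowEqOne _ hd0)
    (horder 1) (horder 2) fun k hk₀ hk => (hcomb hk₀ hk).1
  exact ⟨_, r, hr, congrFun (hr.eq_shiftObs (X := fun i => observable (A i)) hd0 rfl h₁
    hcomb₁.1 hcomb₁.2)⟩

theorem IsOptimal.jointProb_eq (hA : IsOptimal A) (hd : 1 < d) (i j : Fin 4) (a b : Fin d) :
    jointProb (A i) (A j) a b = (d : ℝ)⁻¹ * optimalProb d i j a b := by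
  obtain ⟨u, r, hr, hobs⟩ := hA.exists_isShiftResolution hd
  have hD : (D : ℂ) ≠ 0 := Nat.cast_ne_zero.2 hA.dim_pos.ne'
  apply Complex.ofReal_injective
  rw [(hA.repeatable i).jointProb_eq_trace, ← (hA.repeatable i).spectralProj_observable,
    ← (hA.repeatable j).spectralProj_observable, hobs, hobs, trace_spectralProj_shiftObs_mul hr,
    Fintype.card_fin]
  push_cast
  field_simp

theorem IsOptimal.prob_eq (hA : IsOptimal A) (hd : 1 < d) (i : Fin 4) (a : Fin d) :
    prob (A i) a = (d : ℝ)⁻¹ := by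
  rw [← hA.repeatable i a, hA.jointProb_eq hd, optimalProb_self_self, mul_one]

theorem IsOptimal.condProb_eq (hA : IsOptimal A) (hd : 1 < d) (i j : Fin 4) (a b : Fin d) :
    condProb (A i) (A j) a b = optimalProb d i j a b := by
  have hd' : (d : ℝ)⁻¹ ≠ 0 := inv_ne_zero (Nat.cast_ne_zero.2 (by omega))
  rw [condProb, hA.prob_eq hd, hA.jointProb_eq hd, mul_div_cancel_left₀ _ hd']

end Classification

/-! ### Strategies from shift resolutions -/

section Construction

variable {d D : ℕ} {U : Matrix (Fin D) (Fin D) ℂ}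

/-- The projective measurement of a unitary matrix of order dividing `d`. -/
def spectralMeasurement (hd : d ≠ 0) (hU : U ^ d = 1) (hU' : U ∈ unitary (Matrix _ _ ℂ)) :
    Measurement d D where
  kraus a := spectralProj d U a
  complete := by
    simp only [← Matrix.star_eq_conjTranspose,
      (isStarProjection_spectralProj hU hU' _).isSelfAdjoint.star_eq,
      (isStarProjection_spectralProj hU hU' _).isIdempotentElem.eq, sum_spectralProj hd]

theorem isRepeatable_spectralMeasurement (hd : d ≠ 0) (hU : U ^ d = 1)
    (hU' : U ∈ unitary (Matrix _ _ ℂ)) : IsRepeatable (spectralMeasurement hd hU hU') :=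
  isRepeatable_of_isIdempotentElem fun a =>
    (isStarProjection_spectralProj hU hU' a).isIdempotentElem

theorem observable_spectralMeasurement (hd : d ≠ 0) (hU : U ^ d = 1)
    (hU' : U ∈ unitary (Matrix _ _ ℂ)) : observable (spectralMeasurement hd hU hU') = U := by
  simp only [observable, effect, spectralMeasurement, ← Matrix.star_eq_conjTranspose,
    (isStarProjection_spectralProj hU hU' _).isSelfAdjoint.star_eq,
    (isStarProjection_spectralProj hU hU' _).isIdempotentElem.eq, sum_smul_spectralProj hd hU]

theorem isOptimal_of_observable_eq_shiftObs {A : Strategy d D} {u : (Matrix (Fin D) (Fin D) ℂ)ˣ}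
    {r : Matrix (Fin D) (Fin D) ℂ} (h : IsShiftResolution d u r) (hd : d ≠ 0) (hD : 0 < D)
    (hA : ∀ i, IsRepeatable (A i)) (hobs : ∀ i, observable (A i) = shiftObs d u r i) :
    IsOptimal A :=
  isOptimal_of_defect_eq_zero hA hD hd fun k _ hk => by
    simp only [defect_eq_zero_iff, hobs, h.shiftObs_two_pow hd hk.le,
      h.shiftObs_three_pow hd hk.le, and_self]

end Construction

/-! ### The `d`-dimensional reference observables -/

section Reference

variable {d : ℕ}

/-- The vector, of squared norm `d`, onto which the reference shift resolution projects. -/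
def refVec (d : ℕ) (q : Fin d) : ℂ :=
  (if (q : ℕ) = 0 then (-1 : ℂ) else 1) * omegaPow d ((q : ℝ) / 2)

/-- The rank-one projection whose conjugates under the powers of `Z_d` form the reference shift
resolution. -/
def refProj (d : ℕ) : Matrix (Fin d) (Fin d) ℂ :=
  Matrix.of fun q s => (d : ℂ)⁻¹ * (refVec d q * conj (refVec d s))

theorem refVec_mul_conj (q : Fin d) : refVec d q * conj (refVec d q) = 1 := by
  rw [Complex.mul_conj', refVec, norm_mul, norm_omegaPow]
  split_ifs <;> simp

theorem conj_refVec_mul (q : Fin d) : conj (refVec d q) * omegaPow d q = refVec d q := by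
  have hq : omegaPow d q = omegaPow d (q / 2) * omegaPow d (q / 2) := by
    rw [← omegaPow_add, add_halves]
  have hne := omegaPow_ne_zero d (q / 2)
  rw [refVec, hq, map_mul, conj_omegaPow]
  split_ifs <;> simp [hne]

theorem isSelfAdjoint_refProj (d : ℕ) : IsSelfAdjoint (refProj d) := by
  ext q s
  rw [Matrix.star_apply, refProj, Matrix.of_apply, Matrix.of_apply, ← starRingEnd_apply,
    map_mul, map_mul, map_inv₀, map_natCast, Complex.conj_conj, mul_comm (conj _)]

theorem obsZ_pow (d k : ℕ) : obsZ d ^ k = Matrix.diagonal fun q : Fin d => omegaPow d q ^ k := by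
  rw [obsZ, Matrix.diagonal_pow]
  rfl

theorem obsZ_pow_self (hd : d ≠ 0) : obsZ d ^ d = 1 := by
  simp only [obsZ_pow, omegaPow_natCast_pow_self hd, Matrix.diagonal_one]

theorem obsZ_mem_unitary (d : ℕ) : obsZ d ∈ unitary (Matrix (Fin d) (Fin d) ℂ) := by
  refine Matrix.mem_unitaryGroup_iff'.2 ?_
  rw [obsZ, Matrix.star_eq_conjTranspose, Matrix.diagonal_conjTranspose,
    Matrix.diagonal_mul_diagonal, ← Matrix.diagonal_one]
  congr 1
  funext q
  rw [Pi.star_apply, ← starRingEnd_apply, conj_omegaPow, inv_mul_cancel₀ (omegaPow_ne_zero d _)]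

/-- `Z_d` as an invertible matrix. -/
def unitZ (hd : d ≠ 0) : (Matrix (Fin d) (Fin d) ℂ)ˣ :=
  Units.ofPowEqOne (obsZ d) d (obsZ_pow_self hd) hd

theorem val_unitZ (hd : d ≠ 0) : (unitZ hd : Matrix (Fin d) (Fin d) ℂ) = obsZ d := rfl

theorem translate_refProj_apply (hd : d ≠ 0) (j : ℕ) (q s : Fin d) :
    translate (unitZ hd) (refProj d) j q s
      = refProj d q s * ((omegaPow d s)⁻¹ * omegaPow d q) ^ j := by
  have h := congrFun (congrFun (translate_mul_pow (unitZ hd) (refProj d) j) q) s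
  rw [val_unitZ, obsZ_pow, Matrix.mul_diagonal, Matrix.diagonal_mul] at h
  have hs := omegaPow_ne_zero d s
  rw [mul_pow, inv_pow]
  field_simp
  rw [h, mul_comm]

theorem refProj_mul_translate (hd : d ≠ 0) {j : ℕ} (hj₀ : 0 < j) (hj : j < d) :
    refProj d * translate (unitZ hd) (refProj d) j = 0 := by
  ext q s
  have hterm (r : Fin d) : refProj d q r * translate (unitZ hd) (refProj d) j r s
      = (d : ℂ)⁻¹ * refProj d q s * (omegaPow d s)⁻¹ ^ j * omegaPow d r ^ j := by
    rw [translate_refProj_apply]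
    simp only [refProj, Matrix.of_apply]
    linear_combination (d : ℂ)⁻¹ * (d : ℂ)⁻¹ * refVec d q * conj (refVec d s)
      * ((omegaPow d s)⁻¹ * omegaPow d r) ^ j * refVec_mul_conj r
  simp only [Matrix.mul_apply, hterm, ← mul_sum, sum_omegaPow_pow hj, if_neg hj₀.ne', mul_zero,
    Matrix.zero_apply]

theorem sum_translate_refProj (hd : d ≠ 0) :
    ∑ j ∈ range d, translate (unitZ hd) (refProj d) j = 1 := by
  ext q s
  simp only [Matrix.sum_apply, translate_refProj_apply, ← mul_sum, sum_inv_mul_omegaPow_pow,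
    Matrix.one_apply, eq_comm (a := s)]
  split_ifs with hqs
  · simp [refProj, hqs, refVec_mul_conj, hd]
  · rw [mul_zero]

theorem isShiftResolution_refProj (hd : d ≠ 0) : IsShiftResolution d (unitZ hd) (refProj d) :=
  isShiftResolution_of_mul_translate_eq_zero (Units.pow_ofPowEqOne _ hd)
    (fun _ => refProj_mul_translate hd) (sum_translate_refProj hd)

theorem isStarProjection_refProj (hd : d ≠ 0) : IsStarProjection (refProj d) :=
  ⟨(isShiftResolution_refProj hd).mul_self hd, isSelfAdjoint_refProj d⟩

theorem obsT_eq_shiftObs (hd : d ≠ 0) : obsT d = shiftObs d (unitZ hd) (refProj d) 1 := by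
  ext q s
  have hω : omegaPow d ((q + s + 1) / 2)
      = omegaPow d (q / 2) * omegaPow d (s / 2) * omegaPow d (1 / 2) := by
    rw [← omegaPow_add, ← omegaPow_add]
    congr 1
    ring
  have hmul : (refProj d * obsZ d) q s = (d : ℂ)⁻¹ * (refVec d q * refVec d s) := by
    rw [obsZ, Matrix.mul_diagonal, refProj, Matrix.of_apply]
    linear_combination (d : ℂ)⁻¹ * refVec d q * conj_refVec_mul s
  change _ = twistedShift d (unitZ hd) (refProj d) (omegaPow d (1 / 2)) q s
  rw [twistedShift, one_sub_inv_omegaPow_half_pow_self hd, val_unitZ, sub_mul, one_mul,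
    smul_mul_assoc, Matrix.smul_apply, Matrix.sub_apply, Matrix.smul_apply, hmul, obsT, obsZ,
    Matrix.sub_apply, Matrix.smul_apply, Matrix.of_apply, hω]
  simp only [Matrix.diagonal_apply, refVec, smul_eq_mul, omegaPow_add]
  split_ifs <;> ring

theorem refObs_eq_shiftObs (hd : d ≠ 0) : refObs d = shiftObs d (unitZ hd) (refProj d) := by
  refine (isShiftResolution_refProj hd).eq_shiftObs hd rfl (obsT_eq_shiftObs hd) rfl ?_
  rw [combN, Nat.cast_one, mul_comm (conj _)]
  rfl

theorem refObs_pow_self (hd : d ≠ 0) (i : Fin 4) : refObs d i ^ d = 1 := by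
  rw [refObs_eq_shiftObs hd]
  exact (isShiftResolution_refProj hd).shiftObs_pow_self hd i

theorem refObs_mem_unitary (hd : d ≠ 0) (i : Fin 4) :
    refObs d i ∈ unitary (Matrix (Fin d) (Fin d) ℂ) := by
  rw [refObs_eq_shiftObs hd]
  exact twistedShift_mem_unitary d (obsZ_mem_unitary d) (isStarProjection_refProj hd)
    (norm_omegaPow d _)

theorem trace_spectralProj_refObs_mul (i j : Fin 4) (a b : Fin d) :
    (spectralProj d (refObs d i) a * spectralProj d (refObs d j) b).trace
      = optimalProb d i j a b := by
  have hd : d ≠ 0 := (Fin.pos a).ne'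
  rw [refObs_eq_shiftObs hd, trace_spectralProj_shiftObs_mul (isShiftResolution_refProj hd),
    Fintype.card_fin, div_self (Nat.cast_ne_zero.2 hd), one_mul]

theorem isStarProjection_spectralProj_refObs (i : Fin 4) (a : Fin d) :
    IsStarProjection (spectralProj d (refObs d i) a) :=
  isStarProjection_spectralProj (refObs_pow_self (Fin.pos a).ne' i)
    (refObs_mem_unitary (Fin.pos a).ne' i) a

theorem trace_spectralProj_refObs (i : Fin 4) (a : Fin d) :
    (spectralProj d (refObs d i) a).trace = 1 := by
  rw [← (isStarProjection_spectralProj_refObs i a).isIdempotentElem.eq,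
    trace_spectralProj_refObs_mul, optimalProb_self_self, Complex.ofReal_one]

theorem exists_isOptimal (hd : d ≠ 0) : ∃ A : Strategy d d, IsOptimal A :=
  ⟨fun i => spectralMeasurement hd (refObs_pow_self hd i) (refObs_mem_unitary hd i),
    isOptimal_of_observable_eq_shiftObs (isShiftResolution_refProj hd) hd (Nat.pos_of_ne_zero hd)
      (fun _ => isRepeatable_spectralMeasurement _ _ _) fun i => by
        rw [observable_spectralMeasurement, refObs_eq_shiftObs hd]⟩

end Reference

/-! ### Eigenvectors -/

section Eigenvectors

variable {d : ℕ} {n : Type*} [Fintype n] [DecidableEq n] {U : Matrix n n ℂ}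

theorem exists_norm_eq_one_toEuclideanLin_eq_smul (hU : U ^ d = 1) {a : Fin d}
    (ha : spectralProj d U a ≠ 0) :
    ∃ w : EuclideanSpace ℂ n, ‖w‖ = 1 ∧ Matrix.toEuclideanLin U w = omegaPow d a • w := by
  obtain ⟨x, hx⟩ : ∃ x, Matrix.toEuclideanLin (spectralProj d U a) x ≠ 0 := by
    by_contra! h
    exact ha ((LinearEquiv.map_eq_zero_iff _).1 (LinearMap.ext h))
  set w := Matrix.toEuclideanLin (spectralProj d U a) x with hw
  have heig : Matrix.toEuclideanLin U w = omegaPow d a • w := by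
    rw [hw, Matrix.toLpLin_apply, Matrix.toLpLin_apply, Matrix.mulVec_mulVec, mul_spectralProj hU,
      Matrix.smul_mulVec, WithLp.toLp_smul]
  refine ⟨(‖w‖ : ℂ)⁻¹ • w, ?_, by rw [map_smul, heig, smul_comm]⟩
  rw [norm_smul, norm_inv, Complex.norm_real, norm_norm, inv_mul_cancel₀ (norm_ne_zero_iff.2 hx)]

theorem spectralProj_mulVec {a : Fin d} {v : n → ℂ} (hv : U *ᵥ v = omegaPow d a • v) :
    spectralProj d U a *ᵥ v = v := by
  have hd : (d : ℂ) ≠ 0 := Nat.cast_ne_zero.2 (Fin.pos a).ne'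
  have hfix : ((omegaPow d a)⁻¹ • U) *ᵥ v = v := by
    rw [Matrix.smul_mulVec, hv, inv_smul_smul₀ (omegaPow_ne_zero d _)]
  have hpow (k : ℕ) : ((omegaPow d a)⁻¹ • U) ^ k *ᵥ v = v := by
    induction k with
    | zero => simp
    | succ k ih => rw [pow_succ, ← Matrix.mulVec_mulVec, hfix, ih]
  rw [spectralProj, Matrix.smul_mulVec, Matrix.sum_mulVec, sum_congr rfl fun k _ => hpow k,
    sum_const, card_range, ← Nat.cast_smul_eq_nsmul ℂ, inv_smul_smul₀ hd]

end Eigenvectors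

open scoped ComplexOrder in
theorem eq_vecMulVec_of_isStarProjection {n : Type*} [Fintype n] {P : Matrix n n ℂ}
    (hP : IsStarProjection P) (htrace : P.trace = 1) {v : n → ℂ} (hv : star v ⬝ᵥ v = 1)
    (hPv : P *ᵥ v = v) : P = Matrix.vecMulVec v (star v) := by
  set Q := Matrix.vecMulVec v (star v) with hQ
  have hPstar : Pᴴ = P := hP.isSelfAdjoint.star_eq
  have hQstar : Qᴴ = Q := by rw [hQ, Matrix.conjTranspose_vecMulVec, star_star]
  have hPQ : P * Q = Q := by rw [hQ, Matrix.mul_vecMulVec, hPv]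
  have hQP : Q * P = Q := by
    have h := congrArg Matrix.conjTranspose hPQ
    rwa [Matrix.conjTranspose_mul, hQstar, hPstar] at h
  have hQQ : Q * Q = Q := by rw [hQ, Matrix.vecMulVec_mul_vecMulVec, hv, one_smul]
  have hQtrace : Q.trace = 1 := by rw [hQ, Matrix.trace_vecMulVec, dotProduct_comm, hv]
  have hsq : (P - Q)ᴴ * (P - Q) = P - Q := by
    rw [Matrix.conjTranspose_sub, hPstar, hQstar, sub_mul, mul_sub, mul_sub,
      hP.isIdempotentElem.eq, hPQ, hQP, hQQ, sub_self, sub_zero]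
  refine sub_eq_zero.1 (Matrix.trace_conjTranspose_mul_self_eq_zero_iff.1 ?_)
  rw [hsq, Matrix.trace_sub, htrace, hQtrace, sub_self]

section Eigenstates

variable {d : ℕ}

theorem exists_isEigenstateFamily (hd : d ≠ 0) :
    ∃ v : Fin 4 → Fin d → EuclideanSpace ℂ (Fin d), IsEigenstateFamily v := by
  have hne (i : Fin 4) (a : Fin d) : spectralProj d (refObs d i) a ≠ 0 := fun h => by
    simpa [h] using trace_spectralProj_refObs i a
  choose v hv using fun i a =>
    exists_norm_eq_one_toEuclideanLin_eq_smul (refObs_pow_self hd i) (hne i a)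
  exact ⟨v, hv⟩

theorem overlap_eq_trace (v w : EuclideanSpace ℂ (Fin d)) :
    (overlap v w : ℂ) = (Matrix.vecMulVec v.ofLp (star v.ofLp)
      * Matrix.vecMulVec w.ofLp (star w.ofLp)).trace := by
  rw [Matrix.vecMulVec_mul_vecMulVec, Matrix.trace_vecMulVec, dotProduct_smul, overlap,
    EuclideanSpace.inner_eq_star_dotProduct, Complex.ofReal_pow, ← Complex.mul_conj', smul_eq_mul,
    starRingEnd_apply, ← Matrix.star_dotProduct_star, star_star, dotProduct_comm (star v.ofLp)]

namespace IsEigenstateFamily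

variable {v : Fin 4 → Fin d → EuclideanSpace ℂ (Fin d)}

theorem spectralProj_eq (hv : IsEigenstateFamily v) (i : Fin 4) (a : Fin d) :
    spectralProj d (refObs d i) a = Matrix.vecMulVec (v i a).ofLp (star (v i a).ofLp) := by
  obtain ⟨hnorm, heig⟩ := hv i a
  have hdot : star (v i a).ofLp ⬝ᵥ (v i a).ofLp = 1 := by
    rw [dotProduct_comm, ← EuclideanSpace.inner_eq_star_dotProduct, inner_self_eq_norm_sq_to_K,
      hnorm, RCLike.ofReal_one, one_pow]
  exact eq_vecMulVec_of_isStarProjection (isStarProjection_spectralProj_refObs i a)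
    (trace_spectralProj_refObs i a) hdot (spectralProj_mulVec (congrArg WithLp.ofLp heig))

theorem overlap_eq (hv : IsEigenstateFamily v) (i j : Fin 4) (a b : Fin d) :
    overlap (v i a) (v j b) = optimalProb d i j a b := by
  apply Complex.ofReal_injective
  rw [overlap_eq_trace, ← hv.spectralProj_eq, ← hv.spectralProj_eq, trace_spectralProj_refObs_mul]

end IsEigenstateFamily

end Eigenstates

/-! ### The certified randomness -/

section Periodic

variable {d : ℕ}

theorem periodic_apply_fin_sub {α : Type*} [NeZero d] {g : ℝ → α}
    (hg : Function.Periodic g d) (x y : Fin d) : g ((x - y : Fin d) : ℕ) = g (x - y) := by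
  rcases le_or_gt y x with h | h
  · rw [Fin.coe_sub_iff_le.2 h, Nat.cast_sub h]
  · rw [Fin.coe_sub_iff_lt.2 h, ← hg (x - y), Nat.cast_sub (by omega)]
    congr 1
    push_cast
    ring

theorem sum_periodic_sub_fin {M : Type*} [AddCommMonoid M] {g : ℝ → M}
    (hg : Function.Periodic g d) (a : Fin d) :
    ∑ b : Fin d, g (b - a) = ∑ k ∈ range d, g k := by
  have : NeZero d := ⟨(Fin.pos a).ne'⟩
  rw [← Fin.sum_univ_eq_sum_range (fun k => g k),
    ← Equiv.sum_comp (Equiv.subRight a) fun b : Fin d => g b]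
  exact sum_congr rfl fun b _ => (periodic_apply_fin_sub hg b a).symm

theorem sum_periodic_neg {M : Type*} [AddCommMonoid M] {g : ℝ → M} (hg : Function.Periodic g d) :
    ∑ k ∈ range d, g (-k) = ∑ k ∈ range d, g k := by
  rcases eq_or_ne d 0 with rfl | hd
  · simp
  have : NeZero d := ⟨hd⟩
  rw [← Fin.sum_univ_eq_sum_range (fun k => g k), ← Fin.sum_univ_eq_sum_range (fun k => g (-k)),
    ← Equiv.sum_comp (Equiv.subLeft 0) fun b : Fin d => g b]
  refine sum_congr rfl fun b _ => ?_
  rw [Equiv.subLeft_apply, periodic_apply_fin_sub hg, Fin.val_zero, Nat.cast_zero, zero_sub]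

end Periodic

section Entropy

variable {d D : ℕ}

/-- The entropy of the outcome of `A_j` measured after `A_i` in an optimal strategy. -/
def optimalEntropy (d : ℕ) (i j : Fin 4) : ℝ :=
  -∑ x ∈ range d, fejerKernel d (x - (phaseExponent j - phaseExponent i))
    * Real.logb 2 (fejerKernel d (x - (phaseExponent j - phaseExponent i)))

theorem periodic_fejerKernel_sub_mul_logb (hd : d ≠ 0) (s : ℝ) :
    Function.Periodic (fun t => fejerKernel d (t - s) * Real.logb 2 (fejerKernel d (t - s))) d :=
  fun t => by simp only [add_sub_right_comm, fejerKernel_add_self hd]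

theorem optimalEntropy_eq (i j : Fin 4) (a : Fin d) :
    optimalEntropy d i j = -∑ b, optimalProb d i j a b * Real.logb 2 (optimalProb d i j a b) := by
  rw [optimalEntropy,
    ← sum_periodic_sub_fin (periodic_fejerKernel_sub_mul_logb (Fin.pos a).ne' _) a]
  simp only [optimalProb, sub_sub_sub_comm]

theorem optimalEntropy_comm (hd : d ≠ 0) (i j : Fin 4) :
    optimalEntropy d i j = optimalEntropy d j i := by
  have hneg (x s : ℝ) : fejerKernel d (-x - s) = fejerKernel d (x - -s) := by
    rw [← fejerKernel_neg, neg_sub, sub_neg_eq_add, sub_neg_eq_add, add_comm]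
  rw [optimalEntropy, ← sum_periodic_neg (periodic_fejerKernel_sub_mul_logb hd _)]
  simp only [hneg, neg_sub, optimalEntropy]

theorem optimalEntropy_self (hd : d ≠ 0) (i : Fin 4) : optimalEntropy d i i = 0 := by
  rw [optimalEntropy_eq i i ⟨0, Nat.pos_of_ne_zero hd⟩, neg_eq_zero]
  refine sum_eq_zero fun b _ => ?_
  rcases eq_or_ne ⟨0, Nat.pos_of_ne_zero hd⟩ b with rfl | hb
  · rw [optimalProb_self_self, Real.logb_one, mul_zero]
  · rw [optimalProb_self_of_ne i hb, zero_mul]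

theorem fejerKernel_natCast_sub_natCast_sub_half (hd : d ≠ 0) (m n : ℕ) :
    fejerKernel d (n - m - 1 / 2) = closedFormProb d (n - m - 1 / 2) :=
  fejerKernel_eq_closedFormProb (by
    rw [omegaPow_sub, omegaPow_sub, mul_pow, mul_pow, inv_pow, inv_pow,
      omegaPow_natCast_pow_self hd, omegaPow_natCast_pow_self hd, omegaPow_half_pow_self hd]
    norm_num)

theorem optimalProb_zero_one (a b : Fin d) :
    optimalProb d 0 1 a b = closedFormProb d (b - a - 1 / 2) := by
  rw [← fejerKernel_natCast_sub_natCast_sub_half (Fin.pos a).ne', optimalProb, sub_sub_sub_comm]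
  congr 2
  norm_num [phaseExponent]

theorem optimalEntropy_eq_closedFormEntropy (hd : d ≠ 0) {i j : Fin 4}
    (hij : phaseExponent j - phaseExponent i = 1 / 2) :
    optimalEntropy d i j = closedFormEntropy d := by
  have hclosed (x : ℕ) : fejerKernel d (x - 1 / 2) = closedFormProb d (x - 1 / 2) := by
    simpa using fejerKernel_natCast_sub_natCast_sub_half hd 0 x
  simp only [optimalEntropy, hij, hclosed, closedFormEntropy]

theorem optimalEntropy_zero_one (hd : d ≠ 0) :
    optimalEntropy d 0 1 = closedFormEntropy d :=
  optimalEntropy_eq_closedFormEntropy hd (by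
    simp only [phaseExponent, Matrix.cons_val]
    norm_num)

theorem optimalEntropy_two_three (hd : d ≠ 0) :
    optimalEntropy d 2 3 = closedFormEntropy d :=
  optimalEntropy_eq_closedFormEntropy hd (by
    simp only [phaseExponent, Matrix.cons_val]
    norm_num)

theorem IsOptimal.outcomeEntropy_eq {A : Strategy d D} (hA : IsOptimal A) (hd : 1 < d)
    (i j : Fin 4) : outcomeEntropy (A i) (A j) = optimalEntropy d i j := by
  have hd' : (d : ℝ) ≠ 0 := Nat.cast_ne_zero.2 (by omega)
  have hterm (a : Fin d) : prob (A i) a * ∑ b, condProb (A i) (A j) a b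
      * Real.logb 2 (condProb (A i) (A j) a b) = (d : ℝ)⁻¹ * -optimalEntropy d i j := by
    simp only [hA.condProb_eq hd, hA.prob_eq hd, optimalEntropy_eq i j a, neg_neg]
  rw [outcomeEntropy, sum_congr rfl fun a _ => hterm a, sum_const, card_univ, Fintype.card_fin,
    nsmul_eq_mul, mul_inv_cancel_left₀ hd', neg_neg]

theorem strategyEntropies_eq (hd : 1 < d) (i j : Fin 4) :
    strategyEntropies d i j = {optimalEntropy d i j} := by
  refine Set.Subset.antisymm ?_ (Set.singleton_subset_iff.2 ?_)
  · rintro _ ⟨D, A, hA, rfl⟩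
    exact hA.outcomeEntropy_eq hd i j
  · obtain ⟨A, hA⟩ := exists_isOptimal (d := d) (by omega)
    exact ⟨d, A, hA, (hA.outcomeEntropy_eq hd i j).symm⟩

theorem certifiedRandomness_eq (hd : 1 < d) (i j : Fin 4) :
    certifiedRandomness d i j = optimalEntropy d i j := by
  rw [certifiedRandomness, strategyEntropies_eq hd, csInf_singleton]

end Entropy

end TemporalRandomness

end

open TemporalRandomness in
theorem mainTheorem7 (d : ℕ) (hd : 2 ≤ d) :
    -- the minimum defining the certified randomness is attained, and all admissible
    -- strategies give the same value
    (∀ i j : Fin 4,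
      IsLeast (TemporalRandomness.strategyEntropies d i j)
        (TemporalRandomness.certifiedRandomness d i j)) ∧
    (∀ (D : ℕ) (A : TemporalRandomness.Strategy d D), TemporalRandomness.IsOptimal A →
      ∀ i j : Fin 4, TemporalRandomness.outcomeEntropy (A i) (A j) =
        TemporalRandomness.certifiedRandomness d i j) ∧
    -- the certified randomness in terms of the overlaps of the eigenstates
    (∃ v : Fin 4 → Fin d → EuclideanSpace ℂ (Fin d),
      TemporalRandomness.IsEigenstateFamily v) ∧
    (∀ v : Fin 4 → Fin d → EuclideanSpace ℂ (Fin d),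
      TemporalRandomness.IsEigenstateFamily v →
      (∀ (i j : Fin 4) (a : Fin d), TemporalRandomness.certifiedRandomness d i j =
        -∑ b : Fin d, TemporalRandomness.overlap (v i a) (v j b) *
          Real.logb 2 (TemporalRandomness.overlap (v i a) (v j b))) ∧
      (∀ a b : Fin d, TemporalRandomness.overlap (v 0 a) (v 1 b) =
        TemporalRandomness.closedFormProb d ((b : ℝ) - (a : ℝ) - 1 / 2))) ∧
    -- no randomness from repeating a measurement
    (∀ i : Fin 4, TemporalRandomness.certifiedRandomness d i i = 0) ∧
    -- the closed form for the orders (1,2), (2,1), (3,4), (4,3)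
    TemporalRandomness.certifiedRandomness d 0 1 = TemporalRandomness.closedFormEntropy d ∧
    TemporalRandomness.certifiedRandomness d 1 0 = TemporalRandomness.closedFormEntropy d ∧
    TemporalRandomness.certifiedRandomness d 2 3 = TemporalRandomness.closedFormEntropy d ∧
    TemporalRandomness.certifiedRandomness d 3 2 = TemporalRandomness.closedFormEntropy d := by
  have hd0 : d ≠ 0 := by omega
  have h01 := optimalEntropy_zero_one hd0
  have h23 := optimalEntropy_two_three hd0
  simp only [certifiedRandomness_eq hd]
  refine ⟨fun i j => ?_, fun D A hA => hA.outcomeEntropy_eq hd, exists_isEigenstateFamily hd0,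
    fun v hv => ⟨fun i j a => ?_, fun a b => ?_⟩, optimalEntropy_self hd0,
    h01, optimalEntropy_comm hd0 0 1 ▸ h01, h23, optimalEntropy_comm hd0 2 3 ▸ h23⟩
  · rw [strategyEntropies_eq hd]
    exact isLeast_singleton
  · simp only [hv.overlap_eq]
    exact optimalEntropy_eq i j a
  · rw [hv.overlap_eq, optimalProb_zero_one]
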